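/- Let $\mathcal H=\mathbb C^d$ with $1\le d<\infty$, and let $A=(A_x)_{x\in X}$ and $B=(B_y)_{y\in Y}$ be POVMs on $\mathcal H$ with finitely many outcomes, i.e. families of positive operators with $\sum_xA_x=\mathbb 1$ and $\sum_yB_y=\mathbb 1$. An instrument implementing $A$ is a family $\mathcal I=(\mathcal I_x)_{x\in X}$ of completely positive linear maps on the operators of $\mathcal H$ with $\mathcal I_x^*(\mathbb 1)=A_x$, where $\mathrm{tr}[S\,\mathcal I_x(T)]=\mathrm{tr}[\mathcal I_x^*(S)T]$ for all operators $S,T$; put $\mathcal I=\sum_x\mathcal I_x$. One says that $A$ can be measured without disturbing $B$ if some instrument implementing $A$ satisfies $\mathrm{tr}[\mathcal I(\varrho)B_y]=\mathrm{tr}[\varrho B_y]$ for all states $\varrho$ and all $y$. The minimal disturbance is $$D_A(B)=\inf\{\lambda\in[0,1] : \text{some instrument } \mathcal I \text{ implementing } A \text{ satisfies } -\lambda\mathbb 1\le B_y-\mathcal I^*(B_y)\le\lambda\mathbb 1\ \ \forall y\}.$$ Let $D_A^*(B)$ be the supremum of $\sum_x\mathrm{tr}[H_xA_x]-\sum_y\mathrm{tr}[K_yB_y]$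 over all selfadjoint operators $H_x$ $(x\in X)$, $K_y$ $(y\in Y)$ with $$H_x\otimes\mathbb 1\le\sum_yK_y\otimes B_y^T\ \text{ for all }x,\qquad \sum_y\mathrm{tr}|K_y|=1 .$$ Then the following hold. 1. The infimum defining $D_A(B)$ is attained. 2. Selfadjoint operator bases $(E_i)_{0\le i<d^2}$ with $\mathrm{tr}[E_iE_j]=\delta_{ij}$ and $E_0=\mathbb 1/\sqrt d$ exist. For each of them consider the program of minimizing $\lambda$ over real variables $\lambda$ and $c_{xij}$ ($x\in X$, $0\le i,j<d^2$) subject to $$\pm\tfrac1{\sqrt d}A_x\le\pm\sum_jc_{x0j}E_j\ \ (\forall x),\qquad 0\le\sum_{i,j}c_{xij}\,E_j\otimes E_i^T\ \ (\forall x),\qquad \pm B_y\le\lambda\sqrt d\,E_0\pm\sum_{x,i,j}c_{xij}\,\mathrm{tr}[E_iB_y]\,E_j\ \ (\forall y).$$ Combined by a direct sum, it is a semidefinite program $\inf\{\langle v,c\rangle : F_0\le\sum_\ell c_\ell F_\ell\}$ with Hermitian $F_0,F_\ell$. - Its feasible points are exactly those with $c_{xij}=\mathrm{tr}[E_j\mathcal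 I_x^*(E_i)]$ for some instrument $\mathcal I$ implementing $A$ and satisfying $-\lambda\mathbb 1\le B_y-\mathcal I^*(B_y)\le\lambda\mathbb 1$ for all $y$. - Its optimal value is $D_A(B)$ and is attained. - The dual program $\sup\{\mathrm{tr}[F_0C] : C\ge0,\ \mathrm{tr}[F_\ell C]=v_\ell\ \forall\ell\}$ is strictly feasible and has the same value $D_A(B)$. 3. $D_A^*(B)$ is finite (the supremum is over a non-empty set bounded above), and $D^*_A(B)=D_A(B)$. 4. Non-disturbance is thereby decided by a semidefinite program of polynomial size, with certificates. The program in 2 has $1+|X|d^4$ real variables and matrices of size $(2d+d^2)|X|+2d|Y|$; all its feasible points with $\lambda\le1$ satisfy $\lambda^2+\sum_{x,i,j} c_{xij}^2\le1+d^2$; and its dual has a feasible point $C\ge\frac1{2d|Y|}\mathbb 1$. Moreover, $A$ can be measured without disturbing $B$ if and only if $D_A(B)=0$, if and only if the program has a feasible point with $\lambda=0$; and $A$ cannot be measured without disturbing $B$ if and only if there are $H_x,K_y$ that satisfy the constraints of $D_A^*(B)$ and for which $\sum_x\mathrm{tr}[H_xA_x]-\sum_y\mathrm{tr}[K_yB_y]>0$.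 -/

import Mathlib

open scoped MatrixOrder ComplexOrder Kronecker

noncomputable section

namespace NonDisturbance

/-! ### Observables, instruments, disturbance

The Hilbert space is `ℂ^n` for a finite index type `n`; operators are matrices and `≤` is the
Loewner order. -/

/-- A discrete observable (POVM) with outcome set `X`. -/
structure Observable (n X : Type*) [Fintype n] [DecidableEq n] [Fintype X] where
  effect : X → Matrix n n ℂ
  nonneg : ∀ x, 0 ≤ effect x
  sum_eq_one : ∑ x, effect x = 1

/-- The map `T ⊗ id_k` on operators of `ℂ^n ⊗ ℂ^k`. -/
def ampliation {n : Type*} (T : Matrix n n ℂ →ₗ[ℂ] Matrix n n ℂ) (k : ℕ)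
    (M : Matrix (n × Fin k) (n × Fin k) ℂ) : Matrix (n × Fin k) (n × Fin k) ℂ :=
  Matrix.of fun p q => T (Matrix.of fun i j => M (i, p.2) (j, q.2)) p.1 q.1

/-- Complete positivity: `T ⊗ id_k` preserves positivity for every `k`. -/
def IsCompletelyPositive {n : Type*} (T : Matrix n n ℂ →ₗ[ℂ] Matrix n n ℂ) : Prop :=
  ∀ (k : ℕ) (M : Matrix (n × Fin k) (n × Fin k) ℂ), 0 ≤ M → 0 ≤ ampliation T k M

/-- The adjoint (Heisenberg picture) map for the trace duality, see `trace_mul_adjointMap`. -/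
def adjointMap {n : Type*} [Fintype n] [DecidableEq n]
    (T : Matrix n n ℂ →ₗ[ℂ] Matrix n n ℂ) : Matrix n n ℂ →ₗ[ℂ] Matrix n n ℂ where
  toFun Z := Matrix.of fun i j => (Z * T (Matrix.single j i 1)).trace
  map_add' Z W := by
    ext i j
    simp [add_mul, Matrix.trace_add]
  map_smul' c Z := by
    ext i j
    simp [Matrix.trace_smul]

theorem trace_mul_adjointMap {n : Type*} [Fintype n] [DecidableEq n]
    (T : Matrix n n ℂ →ₗ[ℂ] Matrix n n ℂ) (Z W : Matrix n n ℂ) :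
    (Z * T W).trace = (adjointMap T Z * W).trace := by
  conv_lhs => rw [Matrix.matrix_eq_sum_single W]
  have h : ∀ i j, Matrix.single i j (W i j) = W i j • Matrix.single i j (1 : ℂ) := by
    intro i j
    simp
  simp only [h, map_sum, map_smul, Finset.mul_sum, Matrix.trace_sum, Matrix.mul_smul,
    Matrix.trace_smul, smul_eq_mul]
  rw [Finset.sum_comm]
  simp [Matrix.trace, Matrix.mul_apply, adjointMap, mul_comm]

/-- An instrument (Schrödinger picture): a family of completely positive linear maps. The
normalization is part of `Instrument.Implements`. -/
structure Instrument (n X : Type*) where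
  op : X → (Matrix n n ℂ →ₗ[ℂ] Matrix n n ℂ)
  cp : ∀ x, IsCompletelyPositive (op x)

section

variable {n X Y : Type*} [Fintype n] [DecidableEq n] [Fintype X] [Fintype Y]

/-- The instrument `I` implements `A`: `I_x^*(1) = A_x` for every outcome. -/
def Instrument.Implements (I : Instrument n X) (A : Observable n X) : Prop :=
  ∀ x, adjointMap (I.op x) 1 = A.effect x

/-- The unconditional state transformation `∑ x, I_x`. -/
def Instrument.channel (I : Instrument n X) : Matrix n n ℂ →ₗ[ℂ] Matrix n n ℂ :=
  ∑ x, I.op x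

/-- Density operators. -/
def IsState (ρ : Matrix n n ℂ) : Prop :=
  0 ≤ ρ ∧ ρ.trace = 1

/-- `A` can be measured without disturbing `B`. -/
def CanMeasureWithoutDisturbing (A : Observable n X) (B : Observable n Y) : Prop :=
  ∃ I : Instrument n X, I.Implements A ∧
    ∀ ρ, IsState ρ → ∀ y, (I.channel ρ * B.effect y).trace = (ρ * B.effect y).trace

/-- `I` disturbs `B` by at most `t`: `-t 1 ≤ B_y - I^*(B_y) ≤ t 1` for all `y`. -/
def Instrument.DisturbsAtMost (I : Instrument n X) (B : Observable n Y) (t : ℝ) : Prop :=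
  ∀ y, -(t • (1 : Matrix n n ℂ)) ≤ B.effect y - adjointMap I.channel (B.effect y) ∧
    B.effect y - adjointMap I.channel (B.effect y) ≤ t • (1 : Matrix n n ℂ)

/-- All `t ∈ [0,1]` that bound the disturbance of `B` for some instrument implementing `A`. -/
def disturbanceValues (A : Observable n X) (B : Observable n Y) : Set ℝ :=
  {t | t ∈ Set.Icc (0 : ℝ) 1 ∧ ∃ I : Instrument n X, I.Implements A ∧ I.DisturbsAtMost B t}

/-- The minimal disturbance `D_A(B)`. -/
def disturbance (A : Observable n X) (B : Observable n Y) : ℝ :=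
  sInf (disturbanceValues A B)

/-! ### The dual value -/

/-- The constraints of the dual problem: `H_x`, `K_y` are selfadjoint,
`H_x ⊗ 1 ≤ ∑ y, K_y ⊗ B_yᵀ` for all `x`, and `∑ y, tr |K_y| = 1`. -/
structure IsDualFeasible (B : Observable n Y) (H : X → Matrix n n ℂ) (K : Y → Matrix n n ℂ) :
    Prop where
  H_herm : ∀ x, (H x).IsHermitian
  K_herm : ∀ y, (K y).IsHermitian
  kronecker_le : ∀ x, H x ⊗ₖ (1 : Matrix n n ℂ) ≤ ∑ y, K y ⊗ₖ (B.effect y).transpose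
  trace_abs : ∑ y, (CFC.abs (K y)).trace = 1

/-- The objective `∑ x, tr (H_x A_x) - ∑ y, tr (K_y B_y)` (a real number for selfadjoint
arguments). -/
def dualObjective (A : Observable n X) (B : Observable n Y)
    (H : X → Matrix n n ℂ) (K : Y → Matrix n n ℂ) : ℝ :=
  (∑ x, (H x * A.effect x).trace - ∑ y, (K y * B.effect y).trace).re

def dualDisturbanceValues (A : Observable n X) (B : Observable n Y) : Set ℝ :=
  {s | ∃ H K, IsDualFeasible B H K ∧ dualObjective A B H K = s}

/-- The dual value `D*_A(B)`. -/
def dualDisturbance (A : Observable n X) (B : Observable n Y) : ℝ :=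
  sSup (dualDisturbanceValues A B)

end

/-! ### Semidefinite programs -/

/-- A semidefinite program with variables `c ∈ ℝ^V` and Hermitian matrices of format `R × R`:
minimize `⟨v, c⟩` subject to `F₀ ≤ ∑ l, c_l F_l`. -/
structure SDP (V R : Type*) where
  v : V → ℝ
  F₀ : Matrix R R ℂ
  F : V → Matrix R R ℂ
  F₀_herm : F₀.IsHermitian
  F_herm : ∀ l, (F l).IsHermitian

namespace SDP

variable {V R : Type*} [Fintype V] [Fintype R]

def Feasible (P : SDP V R) (c : V → ℝ) : Prop :=
  P.F₀ ≤ ∑ l, c l • P.F l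

def objective (P : SDP V R) (c : V → ℝ) : ℝ :=
  ∑ l, P.v l * c l

def primalValues (P : SDP V R) : Set ℝ :=
  {t | ∃ c, P.Feasible c ∧ P.objective c = t}

/-- Feasibility in the dual program: maximize `tr (F₀ C)` over `C ≥ 0` with `tr (F_l C) = v_l`
for all `l`. -/
def DualFeasible (P : SDP V R) (C : Matrix R R ℂ) : Prop :=
  0 ≤ C ∧ ∀ l, (P.F l * C).trace = (P.v l : ℂ)

def dualValues (P : SDP V R) : Set ℝ :=
  {s | ∃ C, P.DualFeasible C ∧ (P.F₀ * C).trace.re = s}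

end SDP

/-! ### The semidefinite program of the minimal disturbance -/

/-- A selfadjoint operator basis `E` with `tr (E_i E_j) = δ_ij`, one member of which (with index
`zero`) is `1 / √d`. -/
structure OperatorBasis (n κ : Type*) [Fintype n] [DecidableEq n] where
  E : κ → Matrix n n ℂ
  zero : κ
  herm : ∀ i, (E i).IsHermitian
  trace_self : ∀ i, (E i * E i).trace = 1
  trace_ne : ∀ i j, i ≠ j → (E i * E j).trace = 0
  span_eq_top : Submodule.span ℂ (Set.range E) = ⊤
  E_zero : E zero = (1 / Real.sqrt (Fintype.card n)) • (1 : Matrix n n ℂ)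

/-- The direct sum (block diagonal matrix) of three finite families of matrices. -/
def directSum {n X Y : Type*} [DecidableEq X] [DecidableEq Y]
    (P : Bool × X → Matrix n n ℂ) (Q : X → Matrix (n × n) (n × n) ℂ)
    (S : Bool × Y → Matrix n n ℂ) :
    Matrix ((n × (Bool × X)) ⊕ (((n × n) × X) ⊕ (n × (Bool × Y))))
      ((n × (Bool × X)) ⊕ (((n × n) × X) ⊕ (n × (Bool × Y)))) ℂ :=
  Matrix.fromBlocks (Matrix.blockDiagonal P) 0 0
    (Matrix.fromBlocks (Matrix.blockDiagonal Q) 0 0 (Matrix.blockDiagonal S))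

theorem directSum_isHermitian {n X Y : Type*} [DecidableEq X] [DecidableEq Y]
    {P : Bool × X → Matrix n n ℂ} {Q : X → Matrix (n × n) (n × n) ℂ}
    {S : Bool × Y → Matrix n n ℂ} (hP : ∀ p, (P p).IsHermitian) (hQ : ∀ x, (Q x).IsHermitian)
    (hS : ∀ p, (S p).IsHermitian) : (directSum P Q S).IsHermitian := by
  have hP' : (fun p => (P p).conjTranspose) = P := funext fun p => hP p
  have hQ' : (fun p => (Q p).conjTranspose) = Q := funext fun p => hQ p
  have hS' : (fun p => (S p).conjTranspose) = S := funext fun p => hS p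
  simp only [Matrix.IsHermitian, directSum, Matrix.fromBlocks_conjTranspose,
    Matrix.blockDiagonal_conjTranspose, Matrix.conjTranspose_zero, hP', hQ', hS']

theorem isHermitian_real_smul {m : Type*} {M : Matrix m m ℂ} (hM : M.IsHermitian) (r : ℝ) :
    (r • M).IsHermitian := by
  simp [Matrix.IsHermitian, Matrix.conjTranspose_smul, hM.eq]

/-- The sign `+1` or `-1`. -/
def sgn (b : Bool) : ℝ := if b then 1 else -1

section

variable {n X Y κ : Type*} [Fintype n] [DecidableEq n] [Fintype X] [DecidableEq X]
  [Fintype Y] [DecidableEq Y] [DecidableEq κ]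

/-- The program: minimize `λ` over the real variables `λ` (index `Sum.inl ()`) and `c_{xij}`
(index `Sum.inr (x, i, j)`, standing for `tr (E_j I_x^*(E_i))`) subject to

* `± (1/√d) A_x ≤ ± ∑ j, c_{x0j} E_j` for all `x`,
* `0 ≤ ∑ i j, c_{xij} E_j ⊗ E_iᵀ` for all `x`,
* `± B_y ≤ λ √d E_0 ± ∑ x i j, c_{xij} tr (E_i B_y) E_j` for all `y`,

combined into one matrix inequality by a direct sum. -/
def disturbanceSDP (A : Observable n X) (B : Observable n Y) (e : OperatorBasis n κ) :
    SDP (Unit ⊕ X × κ × κ) ((n × (Bool × X)) ⊕ (((n × n) × X) ⊕ (n × (Bool × Y)))) where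
  v := Sum.elim (fun _ => 1) (fun _ => 0)
  F₀ := directSum
    (fun p => sgn p.1 • (1 / Real.sqrt (Fintype.card n)) • A.effect p.2)
    (fun _ => 0)
    (fun p => sgn p.1 • B.effect p.2)
  F := Sum.elim
    (fun _ => directSum (fun _ => 0) (fun _ => 0)
      (fun _ => Real.sqrt (Fintype.card n) • e.E e.zero))
    (fun l => directSum
      (fun p => if p.2 = l.1 ∧ l.2.1 = e.zero then sgn p.1 • e.E l.2.2 else 0)
      (fun x => if x = l.1 then e.E l.2.2 ⊗ₖ (e.E l.2.1).transpose else 0)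
      (fun p => sgn p.1 • (e.E l.2.1 * B.effect p.2).trace.re • e.E l.2.2))
  F₀_herm := by
    refine directSum_isHermitian (fun p => ?_) (fun _ => Matrix.isHermitian_zero) (fun p => ?_)
    · exact isHermitian_real_smul (isHermitian_real_smul
        (Matrix.nonneg_iff_posSemidef.1 (A.nonneg p.2)).isHermitian _) _
    · exact isHermitian_real_smul (Matrix.nonneg_iff_posSemidef.1 (B.nonneg p.2)).isHermitian _
  F_herm := by
    rintro (l | ⟨x, i, j⟩)
    · exact directSum_isHermitian (fun _ => Matrix.isHermitian_zero)
        (fun _ => Matrix.isHermitian_zero) (fun _ => isHermitian_real_smul (e.herm _) _)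
    · refine directSum_isHermitian (fun p => ?_) (fun x' => ?_) (fun p => ?_)
      · dsimp only
        split_ifs
        · exact isHermitian_real_smul (e.herm _) _
        · exact Matrix.isHermitian_zero
      · dsimp only
        split_ifs
        · have h : ((e.E i).transpose).IsHermitian := (e.herm i).transpose
          simp only [Matrix.IsHermitian, Matrix.conjTranspose_kronecker, (e.herm j).eq, h.eq]
        · exact Matrix.isHermitian_zero
      · exact isHermitian_real_smul (isHermitian_real_smul (e.herm _) _) _

end

end NonDisturbance

end

/-!
Through the Choi isomorphism, an instrument implementing `A` is a family of positive matrices `J_x`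
on `ℂ^n ⊗ ℂ^n` whose Heisenberg maps `choiMap (J_x)` send `1` to `A_x` (`exists_instrument_iff`).
The trace of `J_x` is then that of `A_x`, so these families form a compact set and the minimal
disturbance is attained (`isLeast_disturbance`). Expanding `J_x` in the basis `E_j ⊗ E_iᵀ` turns the
three block constraints of the semidefinite program into the positivity of `J_x`, the condition
`I_x^*(1) = A_x`, and the disturbance bound (`feasible_iff`, `feasible_iff_exists_instrument`).
Parseval's identity and `tr J² ≤ (tr J)²` for positive `J` bound the coefficients
(`sum_sq_le_of_feasible`).

For duality, fix `t ≥ 0` below the minimal disturbance. Then the point `(A, B)` lies outside the set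
`reachable B t` of all `((I_x^*(1))_x, (I^*(B_y) + E_y)_y)` with completely positive `I_x` and
`-t ≤ E_y ≤ t`. This set is convex, and closed because the traces of the first components control
the Choi matrices. A separating functional consists of selfadjoint `H_x` and `-K_y`. Being bounded
on the cone of the `J_x` it satisfies `H_x ⊗ 1 ≤ ∑ y, K_y ⊗ B_yᵀ`, and the choice of `E_y` as the
multiple of the sign of `K_y` by `-t` gives
`t ∑ y, tr |K_y| < ∑ x, tr (H_x A_x) - ∑ y, tr (K_y B_y)` (`exists_separating`);
normalizing yields a dual value above `t` (`exists_isDualFeasible_lt`).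
Conversely each pair `(H, K)` gives a point of the dual semidefinite program with the same
objective (`dualDisturbanceValues_subset`), so weak duality for semidefinite programs bounds both
dual values by the minimal disturbance. Both suprema therefore equal it.
-/

namespace NonDisturbance

open Matrix

/-! ### Positive matrices and the trace -/

section Positive

variable {m : Type*}

theorem re_diag_nonneg {M : Matrix m m ℂ} (hM : 0 ≤ M) (i : m) : 0 ≤ (M i i).re :=
  (Complex.nonneg_iff.1 (nonneg_iff_posSemidef.1 hM).diag_nonneg).1

/-- The `2 × 2` principal minors of a positive matrix are nonnegative. -/
theorem normSq_apply_le {M : Matrix m m ℂ} (hM : 0 ≤ M) (i j : m) :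
    Complex.normSq (M i j) ≤ (M i i).re * (M j j).re := by
  have hP := nonneg_iff_posSemidef.1 hM
  have h := (hP.submatrix ![i, j]).det_nonneg
  have hji : M j i = star (M i j) := (hP.isHermitian.apply j i).symm
  have hi := (Complex.nonneg_iff.1 (hP.diag_nonneg (i := i))).2
  have hj := (Complex.nonneg_iff.1 (hP.diag_nonneg (i := j))).2
  rw [det_fin_two] at h
  have h' := (Complex.nonneg_iff.1 h).1
  simp [hji, ← hi, ← hj] at h'
  rw [Complex.normSq_apply]
  linarith

theorem smul_nonneg_matrix {r : ℝ} (hr : 0 ≤ r) {M : Matrix m m ℂ} (hM : 0 ≤ M) : 0 ≤ r • M :=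
  nonneg_iff_posSemidef.2 ((nonneg_iff_posSemidef.1 hM).smul hr)

variable [Fintype m]

theorem trace_mul_nonneg {P Q : Matrix m m ℂ} (hP : 0 ≤ P) (hQ : 0 ≤ Q) : 0 ≤ (P * Q).trace := by
  classical
  obtain ⟨R, rfl⟩ := CStarAlgebra.nonneg_iff_eq_star_mul_self.1 hP
  rw [Matrix.mul_assoc, trace_mul_comm]
  exact ((nonneg_iff_posSemidef.1 hQ).mul_mul_conjTranspose_same R).trace_nonneg

theorem trace_mul_le_trace_mul {P Q R : Matrix m m ℂ} (h : P ≤ Q) (hR : 0 ≤ R) :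
    (P * R).trace ≤ (Q * R).trace := by
  have := trace_mul_nonneg (sub_nonneg.2 h) hR
  rwa [sub_mul, trace_sub, sub_nonneg] at this

theorem trace_mul_vecMulVec_star (M : Matrix m m ℂ) (x : m → ℂ) :
    (M * vecMulVec x (star x)).trace = star x ⬝ᵥ (M *ᵥ x) := by
  rw [mul_vecMulVec, trace_vecMulVec, dotProduct_comm]

/-- A Hermitian matrix is positive if its trace pairing with every positive matrix is. -/
theorem nonneg_of_re_trace_mul_nonneg {M : Matrix m m ℂ} (hM : M.IsHermitian)
    (h : ∀ P : Matrix m m ℂ, 0 ≤ P → 0 ≤ (M * P).trace.re) : 0 ≤ M := by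
  refine nonneg_iff_posSemidef.2 (PosSemidef.of_dotProduct_mulVec_nonneg hM fun x => ?_)
  have h1 := h _ (posSemidef_vecMulVec_self_star x).nonneg
  rw [trace_mul_vecMulVec_star] at h1
  exact Complex.nonneg_iff.2 ⟨h1, (hM.im_star_dotProduct_mulVec_self x).symm⟩

theorem trace_mul_im_eq_zero {H K : Matrix m m ℂ} (hH : H.IsHermitian) (hK : K.IsHermitian) :
    (H * K).trace.im = 0 := by
  rw [← Complex.conj_eq_iff_im, ← Complex.star_def, ← trace_conjTranspose, conjTranspose_mul,
    hH.eq, hK.eq, trace_mul_comm]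

theorem trace_mul_eq_ofReal {H K : Matrix m m ℂ} (hH : H.IsHermitian) (hK : K.IsHermitian) :
    (((H * K).trace.re : ℝ) : ℂ) = (H * K).trace :=
  Complex.ext rfl (by simp [trace_mul_im_eq_zero hH hK])

/-- For positive `M` the Hilbert–Schmidt norm is bounded by the trace: `tr M² ≤ (tr M)²`. -/
theorem re_trace_mul_self_le {M : Matrix m m ℂ} (hM : 0 ≤ M) :
    (M * M).trace.re ≤ M.trace.re ^ 2 := by
  have hP := nonneg_iff_posSemidef.1 hM
  have h1 : (M * M).trace.re = ∑ i, ∑ j, Complex.normSq (M i j) := by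
    simp only [trace, diag_apply, mul_apply, Complex.re_sum]
    refine Finset.sum_congr rfl fun i _ => Finset.sum_congr rfl fun j _ => ?_
    rw [show M j i = star (M i j) from (hP.isHermitian.apply j i).symm, Complex.star_def,
      Complex.mul_conj, Complex.ofReal_re]
  rw [h1, sq]
  simp only [trace, diag_apply, Complex.re_sum]
  rw [Finset.sum_mul_sum]
  exact Finset.sum_le_sum fun i _ => Finset.sum_le_sum fun j _ => normSq_apply_le hM i j

theorem norm_apply_le_re_trace {M : Matrix m m ℂ} (hM : 0 ≤ M) (i j : m) :
    ‖M i j‖ ≤ M.trace.re := by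
  have hd : ∀ k, (M k k).re ≤ M.trace.re := fun k => by
    simp only [trace, diag_apply, Complex.re_sum]
    exact Finset.single_le_sum (f := fun k => (M k k).re) (fun k _ => re_diag_nonneg hM k)
      (Finset.mem_univ k)
  have h0 := (re_diag_nonneg hM i).trans (hd i)
  refine abs_le_of_sq_le_sq' ?_ h0 |>.2
  rw [← Complex.normSq_eq_norm_sq, sq]
  exact (normSq_apply_le hM i j).trans
    (mul_le_mul (hd i) (hd j) (re_diag_nonneg hM j) h0)

theorem eq_zero_of_re_trace_nonpos {M : Matrix m m ℂ} (hM : 0 ≤ M) (h : M.trace.re ≤ 0) :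
    M = 0 := by
  ext i j
  exact norm_le_zero_iff.1 ((norm_apply_le_re_trace hM i j).trans h)

theorem isClosed_nonneg : IsClosed {M : Matrix m m ℂ | 0 ≤ M} := by
  have : {M : Matrix m m ℂ | 0 ≤ M} = {M | M.IsHermitian} ∩
      ⋂ x : m → ℂ, {M | 0 ≤ (star x ⬝ᵥ (M *ᵥ x)).re} := by
    ext M
    simp only [Set.mem_ofPred_eq, Set.mem_inter_iff, Set.mem_iInter]
    constructor
    · exact fun h => ⟨(nonneg_iff_posSemidef.1 h).isHermitian, fun x =>
        (Complex.nonneg_iff.1 ((nonneg_iff_posSemidef.1 h).dotProduct_mulVec_nonneg x)).1⟩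
    · rintro ⟨hM, h⟩
      exact nonneg_iff_posSemidef.2 (PosSemidef.of_dotProduct_mulVec_nonneg hM fun x =>
        Complex.nonneg_iff.2 ⟨h x, (hM.im_star_dotProduct_mulVec_self x).symm⟩)
  rw [this]
  refine IsClosed.inter (isClosed_eq (by fun_prop) continuous_id) (isClosed_iInter fun x => ?_)
  exact isClosed_le continuous_const (by fun_prop)

theorem isCompact_nonneg_trace_le (c : ℝ) :
    IsCompact {M : Matrix m m ℂ | 0 ≤ M ∧ M.trace.re ≤ c} := by
  have hK : IsCompact (Set.univ.pi fun _ : m => Set.univ.pi fun _ : m =>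
      Metric.closedBall (0 : ℂ) c) :=
    isCompact_univ_pi fun _ => isCompact_univ_pi fun _ => isCompact_closedBall _ _
  refine IsCompact.of_isClosed_subset hK
    (isClosed_nonneg.inter (isClosed_le
      (Complex.continuous_re.comp (continuous_id.matrix_trace)) continuous_const)) ?_
  rintro M ⟨hM, hc⟩ i - j -
  exact mem_closedBall_zero_iff.2 ((norm_apply_le_re_trace hM i j).trans hc)

/-- Summing the blocks of a positive block matrix gives a positive matrix. -/
theorem posSemidef_sum_blocks {ι : Type*} [Fintype ι] {N : Matrix (ι × m) (ι × m) ℂ}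
    (hN : N.PosSemidef) :
    (Matrix.of fun p q => ∑ i, ∑ j, N (i, p) (j, q) : Matrix m m ℂ).PosSemidef := by
  refine PosSemidef.of_dotProduct_mulVec_nonneg ?_ fun x => ?_
  · ext p q
    simp only [conjTranspose_apply, of_apply, star_sum]
    rw [Finset.sum_comm]
    simp only [hN.isHermitian.apply]
  · convert hN.dotProduct_mulVec_nonneg (fun ip => x ip.2) using 1
    simp only [dotProduct, mulVec, of_apply, Fintype.sum_prod_type, Finset.mul_sum,
      Finset.sum_mul, Pi.star_apply]
    calc _ = ∑ p, ∑ i, ∑ q, ∑ j, star (x p) * (N (i, p) (j, q) * x q) :=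
          Finset.sum_congr rfl fun p _ => Finset.sum_comm
      _ = ∑ i, ∑ p, ∑ q, ∑ j, star (x p) * (N (i, p) (j, q) * x q) := Finset.sum_comm
      _ = _ := Finset.sum_congr rfl fun i _ => Finset.sum_congr rfl fun p _ => Finset.sum_comm

end Positive

/-! ### Choi matrices -/

section Choi

variable {n : Type*} [Fintype n]

/-- The operator map with Choi matrix `J`: `J = K ⊗ W` acts as `Z ↦ tr (Wᵀ Z) K`. In the Heisenberg
picture, instruments correspond to families of positive Choi matrices. -/
def choiMap : Matrix (n × n) (n × n) ℂ →ₗ[ℂ] Matrix n n ℂ →ₗ[ℂ] Matrix n n ℂ :=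
  LinearMap.mk₂ ℂ (fun J Z => Matrix.of fun i j => ∑ a, ∑ b, Z a b * J (i, a) (j, b))
    (by intro J J' Z; ext i j; simp [mul_add, Finset.sum_add_distrib])
    (by intro c J Z; ext i j; simp [Finset.mul_sum, mul_left_comm])
    (by intro J Z Z'; ext i j; simp [add_mul, Finset.sum_add_distrib])
    (by intro c J Z; ext i j; simp [Finset.mul_sum, mul_assoc])

theorem choiMap_apply (J : Matrix (n × n) (n × n) ℂ) (Z : Matrix n n ℂ) (i j : n) :
    choiMap J Z i j = ∑ a, ∑ b, Z a b * J (i, a) (j, b) := rfl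

theorem trace_mul_choiMap (J : Matrix (n × n) (n × n) ℂ) (K Z : Matrix n n ℂ) :
    (K * choiMap J Z).trace = ((K ⊗ₖ Zᵀ) * J).trace := by
  simp only [trace, diag_apply, mul_apply, choiMap_apply, kronecker_apply, transpose_apply,
    Fintype.sum_prod_type, Finset.mul_sum]
  refine Finset.sum_congr rfl fun j _ => ?_
  calc _ = ∑ i, ∑ b, ∑ a, K j i * (Z a b * J (i, a) (j, b)) :=
        Finset.sum_congr rfl fun i _ => Finset.sum_comm
    _ = ∑ b, ∑ i, ∑ a, K j i * (Z a b * J (i, a) (j, b)) := Finset.sum_comm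
    _ = _ := by simp only [mul_assoc]

theorem choiMap_kronecker (K W Z : Matrix n n ℂ) :
    choiMap (K ⊗ₖ W) Z = (Wᵀ * Z).trace • K := by
  ext i j
  simp only [choiMap_apply, kronecker_apply, Matrix.smul_apply, smul_eq_mul, trace, diag_apply,
    mul_apply, transpose_apply, Finset.sum_mul]
  rw [Finset.sum_comm]
  exact Finset.sum_congr rfl fun a _ => Finset.sum_congr rfl fun b _ => by ring

theorem choiMap_isHermitian {J : Matrix (n × n) (n × n) ℂ} {Z : Matrix n n ℂ}
    (hJ : J.IsHermitian) (hZ : Z.IsHermitian) : (choiMap J Z).IsHermitian := by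
  ext i j
  simp only [conjTranspose_apply, choiMap_apply, star_sum, star_mul']
  rw [Finset.sum_comm]
  simp only [hJ.apply, hZ.apply]

theorem choiMap_nonneg {J : Matrix (n × n) (n × n) ℂ} {Z : Matrix n n ℂ} (hJ : 0 ≤ J)
    (hZ : 0 ≤ Z) : 0 ≤ choiMap J Z := by
  have hJ' := nonneg_iff_posSemidef.1 hJ
  have hZ' := nonneg_iff_posSemidef.1 hZ
  refine nonneg_of_re_trace_mul_nonneg (choiMap_isHermitian hJ'.isHermitian hZ'.isHermitian)
    fun P hP => ?_
  rw [trace_mul_comm, trace_mul_choiMap]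
  exact (Complex.nonneg_iff.1 (trace_mul_nonneg
    ((nonneg_iff_posSemidef.1 hP).kronecker hZ'.transpose).nonneg hJ)).1

variable [DecidableEq n]

theorem trace_choiMap_one (J : Matrix (n × n) (n × n) ℂ) : (choiMap J 1).trace = J.trace := by
  have := trace_mul_choiMap J 1 1
  simpa using this

theorem choiMap_single (J : Matrix (n × n) (n × n) ℂ) (a b i j : n) :
    choiMap J (single a b 1) i j = J (i, a) (j, b) := by
  simp [choiMap_apply, single_apply, ite_and]

theorem choiMap_injective :
    Function.Injective (choiMap : Matrix (n × n) (n × n) ℂ →ₗ[ℂ] _ →ₗ[ℂ] Matrix n n ℂ) := by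
  intro J J' h
  refine Matrix.ext fun p q => ?_
  rw [← choiMap_single J p.2 q.2 p.1 q.1, h, choiMap_single]

/-- The Heisenberg picture of a completely positive map has a positive Choi matrix: apply the map
to one half of the (unnormalized) maximally entangled state. -/
theorem IsCompletelyPositive.exists_choi {T : Matrix n n ℂ →ₗ[ℂ] Matrix n n ℂ}
    (hT : IsCompletelyPositive T) : ∃ J, 0 ≤ J ∧ adjointMap T = choiMap J := by
  let J : Matrix (n × n) (n × n) ℂ := Matrix.of fun p q => T (single q.1 p.1 1) q.2 p.2
  refine ⟨J, ?_, ?_⟩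
  · let e := Fintype.equivFin n
    let v : n × Fin (Fintype.card n) → ℂ := fun p => if e p.1 = p.2 then 1 else 0
    have h := nonneg_iff_posSemidef.1 (hT _ _ (posSemidef_vecMulVec_self_star v).nonneg)
    have hJ : J = (((ampliation T _ (vecMulVec v (star v))).submatrix
        (fun p : n × n => (p.2, e p.1)) (fun p : n × n => (p.2, e p.1))))ᵀ := by
      ext ⟨i, a⟩ ⟨j, b⟩
      simp only [J, of_apply, transpose_apply, submatrix_apply, ampliation]
      refine congrFun (congrFun (congrArg T ?_) b) a
      ext k l
      simp [v, vecMulVec_apply, single_apply, ← ite_and, eq_comm, and_comm]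
    rw [hJ]
    exact (h.submatrix _).transpose.nonneg
  · refine LinearMap.ext fun Z => ?_
    ext i j
    simp [adjointMap, choiMap_apply, J, trace, mul_apply]

/-- A positive matrix is the Choi matrix of the Heisenberg picture of a completely positive map. -/
theorem exists_isCompletelyPositive_of_nonneg {J : Matrix (n × n) (n × n) ℂ} (hJ : 0 ≤ J) :
    ∃ T, IsCompletelyPositive T ∧ adjointMap T = choiMap J := by
  let T : Matrix n n ℂ →ₗ[ℂ] Matrix n n ℂ :=
    { toFun := fun W => Matrix.of fun b a => ∑ j, ∑ i, W j i * J (i, a) (j, b)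
      map_add' := by intro W W'; ext; simp [add_mul, Finset.sum_add_distrib]
      map_smul' := by intro c W; ext; simp [Finset.mul_sum, mul_assoc] }
  refine ⟨T, fun k M hM => nonneg_iff_posSemidef.2 ?_, ?_⟩
  · -- `(T ⊗ id) M` is a sum of blocks of the entrywise product of `M` and `Jᵀ`
    have h1 := (nonneg_iff_posSemidef.1 hM).submatrix (fun p : n × (n × Fin k) => (p.1, p.2.2))
    have h2 := (nonneg_iff_posSemidef.1 hJ).transpose.submatrix
      (fun p : n × (n × Fin k) => (p.1, p.2.1))
    have h3 := posSemidef_sum_blocks (h1.hadamard h2)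
    have h4 : ampliation T k M = Matrix.of fun p q => ∑ j, ∑ i,
        M (j, p.2) (i, q.2) * J (i, q.1) (j, p.1) := rfl
    rw [h4]
    exact h3
  · refine LinearMap.ext fun Z => ?_
    ext i j
    simp [adjointMap, choiMap_apply, T, trace, mul_apply, single_apply, ite_and]

variable {X Y : Type*} [Fintype X] [Fintype Y]

/-- Instruments in terms of positive Choi matrices, for any property `P` of the Heisenberg maps. -/
theorem exists_instrument_iff (A : Observable n X)
    (P : (X → Matrix n n ℂ →ₗ[ℂ] Matrix n n ℂ) → Prop) :
    (∃ I : Instrument n X, I.Implements A ∧ P fun x => adjointMap (I.op x)) ↔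
      ∃ J : X → Matrix (n × n) (n × n) ℂ, (∀ x, 0 ≤ J x) ∧
        (∀ x, choiMap (J x) 1 = A.effect x) ∧ P fun x => choiMap (J x) := by
  constructor
  · rintro ⟨I, hI, hP⟩
    choose J hJ hIJ using fun x => (I.cp x).exists_choi
    refine ⟨J, hJ, fun x => ?_, by simpa only [← hIJ] using hP⟩
    rw [← hIJ]
    exact hI x
  · rintro ⟨J, hJ, hA, hP⟩
    choose T hT hTJ using fun x => exists_isCompletelyPositive_of_nonneg (hJ x)
    refine ⟨⟨T, hT⟩, fun x => ?_, by simpa only [hTJ] using hP⟩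
    rw [hTJ]
    exact hA x

theorem adjointMap_channel (I : Instrument n X) (Z : Matrix n n ℂ) :
    adjointMap I.channel Z = ∑ x, adjointMap (I.op x) Z := by
  ext i j
  simp [adjointMap, Instrument.channel, Finset.mul_sum, trace_sum, Matrix.sum_apply]

end Choi

/-! ### The infimum is attained -/

section Attained

theorem continuous_choiMap {n : Type*} [Fintype n] (Z : Matrix n n ℂ) :
    Continuous fun J : Matrix (n × n) (n × n) ℂ => choiMap J Z :=
  (choiMap.flip Z).continuous_of_finiteDimensional

variable {n X Y : Type*} [Fintype n] [DecidableEq n] [Fintype X] [Fintype Y]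

theorem Observable.effect_le_one (A : Observable n X) (x : X) : A.effect x ≤ 1 := by
  rw [← A.sum_eq_one]
  exact Finset.single_le_sum (f := A.effect) (fun x _ => A.nonneg x) (Finset.mem_univ x)

theorem Observable.isHermitian (A : Observable n X) (x : X) : (A.effect x).IsHermitian :=
  (nonneg_iff_posSemidef.1 (A.nonneg x)).isHermitian

theorem exists_disturbsAtMost_iff (A : Observable n X) (B : Observable n Y) (t : ℝ) :
    (∃ I : Instrument n X, I.Implements A ∧ I.DisturbsAtMost B t) ↔
      ∃ J : X → Matrix (n × n) (n × n) ℂ, (∀ x, 0 ≤ J x) ∧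
        (∀ x, choiMap (J x) 1 = A.effect x) ∧
        ∀ y, -(t • (1 : Matrix n n ℂ)) ≤ B.effect y - ∑ x, choiMap (J x) (B.effect y) ∧
          B.effect y - ∑ x, choiMap (J x) (B.effect y) ≤ t • (1 : Matrix n n ℂ) := by
  rw [← exists_instrument_iff A fun T =>
    ∀ y, -(t • (1 : Matrix n n ℂ)) ≤ B.effect y - ∑ x, T x (B.effect y) ∧
          B.effect y - ∑ x, T x (B.effect y) ≤ t • (1 : Matrix n n ℂ)]
  simp only [Instrument.DisturbsAtMost, adjointMap_channel]

/-- Measuring `A` and preparing the maximally mixed state implements `A`. -/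
theorem exists_choi_implements [Nonempty n] (A : Observable n X) :
    ∃ J : X → Matrix (n × n) (n × n) ℂ, (∀ x, 0 ≤ J x) ∧ ∀ x, choiMap (J x) 1 = A.effect x := by
  refine ⟨fun x => A.effect x ⊗ₖ ((1 / Fintype.card n : ℝ) • (1 : Matrix n n ℂ)), fun x => ?_,
    fun x => ?_⟩
  · exact ((nonneg_iff_posSemidef.1 (A.nonneg x)).kronecker
      (PosSemidef.one.smul (by positivity))).nonneg
  · rw [choiMap_kronecker]
    simp [trace_smul]

/-- Every instrument disturbs by at most `1`, as both `B_y` and `I^*(B_y)` lie in `[0, 1]`. -/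
theorem one_mem_disturbanceValues [Nonempty n] (A : Observable n X) (B : Observable n Y) :
    1 ∈ disturbanceValues A B := by
  refine ⟨by simp, (exists_disturbsAtMost_iff A B 1).2 ?_⟩
  obtain ⟨J, hJ, hA⟩ := exists_choi_implements A
  refine ⟨J, hJ, hA, fun y => ?_⟩
  have h0 : 0 ≤ ∑ x, choiMap (J x) (B.effect y) :=
    Finset.sum_nonneg fun x _ => choiMap_nonneg (hJ x) (B.nonneg y)
  have h1 : ∑ x, choiMap (J x) (B.effect y) ≤ 1 := by
    rw [← A.sum_eq_one]
    refine Finset.sum_le_sum fun x _ => ?_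
    rw [← hA, ← sub_nonneg, ← map_sub]
    exact choiMap_nonneg (hJ x) (sub_nonneg.2 (B.effect_le_one y))
  rw [one_smul]
  constructor
  · have := sub_le_sub (B.nonneg y) h1
    simpa using this
  · have := sub_le_sub (B.effect_le_one y) h0
    simpa using this

theorem isCompact_disturbanceValues (A : Observable n X) (B : Observable n Y) :
    IsCompact (disturbanceValues A B) := by
  let S : Set (ℝ × (X → Matrix (n × n) (n × n) ℂ)) :=
    (Set.Icc 0 1 ×ˢ Set.univ.pi fun x => {M | 0 ≤ M ∧ M.trace.re ≤ (A.effect x).trace.re}) ∩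
    ((⋂ x, {p | choiMap (p.2 x) 1 = A.effect x}) ∩
      ⋂ y, ({p | 0 ≤ B.effect y - ∑ x, choiMap (p.2 x) (B.effect y) - -(p.1 • 1)} ∩
        {p | 0 ≤ p.1 • 1 - (B.effect y - ∑ x, choiMap (p.2 x) (B.effect y))}))
  have hc : ∀ (Z : Matrix n n ℂ) (x : X), Continuous
      fun p : ℝ × (X → Matrix (n × n) (n × n) ℂ) => choiMap (p.2 x) Z := fun Z x =>
    (continuous_choiMap Z).comp ((continuous_apply x).comp continuous_snd)
  have hS : IsCompact S := by
    refine (isCompact_Icc.prod (isCompact_univ_pi fun x => isCompact_nonneg_trace_le _)).inter_right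
      (IsClosed.inter (isClosed_iInter fun x => isClosed_eq (hc 1 x) continuous_const)
        (isClosed_iInter fun y => IsClosed.inter ?_ ?_))
    · refine isClosed_nonneg.preimage ((continuous_const.sub
        (continuous_finsetSum _ fun x _ => hc _ x)).sub (by fun_prop))
    · refine isClosed_nonneg.preimage (Continuous.sub (by fun_prop) (continuous_const.sub
        (continuous_finsetSum _ fun x _ => hc _ x)))
  convert hS.image continuous_fst using 1
  ext t
  simp only [disturbanceValues, exists_disturbsAtMost_iff, S, Set.mem_ofPred_eq, Set.mem_image,
    Set.mem_inter_iff, Set.mem_prod, Set.mem_pi, Set.mem_univ, true_imp_iff, Set.mem_iInter,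
    sub_nonneg, Prod.exists, exists_and_right, exists_eq_right]
  constructor
  · rintro ⟨ht, J, hJ, hA, hB⟩
    exact ⟨J, ⟨ht, fun x => ⟨hJ x, by rw [← hA, trace_choiMap_one]⟩⟩, hA, hB⟩
  · rintro ⟨J, ⟨ht, hJ⟩, hA, hB⟩
    exact ⟨ht, J, fun x => (hJ x).1, hA, hB⟩

theorem isLeast_disturbance [Nonempty n] (A : Observable n X) (B : Observable n Y) :
    IsLeast (disturbanceValues A B) (disturbance A B) :=
  (isCompact_disturbanceValues A B).isLeast_sInf ⟨1, one_mem_disturbanceValues A B⟩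

/-- A selfadjoint operator is determined by the expectation values in all states. -/
theorem eq_of_forall_state {M N : Matrix n n ℂ} (hM : M.IsHermitian) (hN : N.IsHermitian)
    (h : ∀ ρ, IsState ρ → (ρ * M).trace = (ρ * N).trace) : M = N := by
  have key : ∀ P : Matrix n n ℂ, 0 ≤ P → (M * P).trace = (N * P).trace := by
    intro P hP
    rcases le_or_gt P.trace.re 0 with h0 | h0
    · simp [eq_zero_of_re_trace_nonpos hP h0]
    · have ht : ((P.trace.re : ℝ) : ℂ) = P.trace := by
        simpa using trace_mul_eq_ofReal (nonneg_iff_posSemidef.1 hP).isHermitian isHermitian_one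
      have hs : IsState ((P.trace.re)⁻¹ • P) := by
        refine ⟨smul_nonneg_matrix (by positivity) hP, ?_⟩
        rw [trace_smul, Complex.real_smul, ← ht, ← Complex.ofReal_mul, Complex.ofReal_re,
          inv_mul_cancel₀ h0.ne', Complex.ofReal_one]
      have h2 := h _ hs
      simp only [smul_mul, trace_smul] at h2
      have h3 := smul_right_injective ℂ (inv_ne_zero h0.ne') h2
      rw [trace_mul_comm, h3, trace_mul_comm]
  refine le_antisymm (sub_nonneg.1 (nonneg_of_re_trace_mul_nonneg (hN.sub hM) fun P hP => ?_))
    (sub_nonneg.1 (nonneg_of_re_trace_mul_nonneg (hM.sub hN) fun P hP => ?_)) <;>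
  simp [sub_mul, key P hP]

theorem canMeasureWithoutDisturbing_iff_exists (A : Observable n X) (B : Observable n Y) :
    CanMeasureWithoutDisturbing A B ↔
      ∃ I : Instrument n X, I.Implements A ∧ I.DisturbsAtMost B 0 := by
  refine exists_congr fun I => and_congr_right fun _ => ?_
  have hadj : ∀ ρ y, (I.channel ρ * B.effect y).trace =
      (ρ * adjointMap I.channel (B.effect y)).trace := fun ρ y => by
    rw [trace_mul_comm, trace_mul_adjointMap, trace_mul_comm]
  have hherm : ∀ y, (adjointMap I.channel (B.effect y)).IsHermitian := fun y => by
    rw [adjointMap_channel]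
    refine isSelfAdjoint_sum _ fun x _ => ?_
    obtain ⟨J, hJ, h⟩ := (I.cp x).exists_choi
    rw [h]
    exact choiMap_isHermitian (nonneg_iff_posSemidef.1 hJ).isHermitian (B.isHermitian y)
  constructor
  · intro h y
    rw [eq_of_forall_state (hherm y) (B.isHermitian y) fun ρ hρ => (hadj ρ y).symm.trans (h ρ hρ y)]
    simp
  · intro h ρ _ y
    have h1 := h y
    simp only [zero_smul, neg_zero] at h1
    rw [hadj, ← sub_eq_zero.1 (le_antisymm h1.2 h1.1)]

theorem canMeasureWithoutDisturbing_iff_disturbance [Nonempty n] (A : Observable n X)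
    (B : Observable n Y) : CanMeasureWithoutDisturbing A B ↔ disturbance A B = 0 := by
  have hD := isLeast_disturbance A B
  rw [canMeasureWithoutDisturbing_iff_exists]
  constructor
  · intro h
    exact le_antisymm (hD.2 ⟨by simp, h⟩) hD.1.1.1
  · intro h
    rw [← h]
    exact hD.1.2

end Attained

/-! ### Strong duality -/

section StrongDuality

/-- A complex-linear functional restricts to the pairing with a selfadjoint matrix on selfadjoint
matrices, up to the imaginary part. -/
theorem exists_isHermitian_re_eq {m : Type*} [Fintype m] (g : Matrix m m ℂ →ₗ[ℂ] ℂ) :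
    ∃ H : Matrix m m ℂ, H.IsHermitian ∧
      ∀ M : Matrix m m ℂ, M.IsHermitian → (g M).re = (H * M).trace.re := by
  classical
  let T : Matrix m m ℂ := Matrix.of fun i j => g (single j i 1)
  have hT : ∀ M, g M = (T * M).trace := by
    intro M
    conv_lhs => rw [matrix_eq_sum_single M]
    have h : ∀ i j, single i j (M i j) = M i j • single i j (1 : ℂ) := by simp
    simp only [h, map_sum, map_smul]
    rw [Finset.sum_comm]
    simp [trace, mul_apply, T, mul_comm]
  refine ⟨(1 / 2 : ℝ) • (T + Tᴴ), isHermitian_real_smul (isHermitian_add_transpose_self T) _,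
    fun M hM => ?_⟩
  have h1 : (Tᴴ * M).trace.re = (T * M).trace.re := by
    rw [← hM.eq, ← conjTranspose_mul, trace_conjTranspose, trace_mul_comm, hM.eq]
    simp
  rw [hT, smul_mul, trace_smul, add_mul, trace_add, Complex.smul_re, Complex.add_re, h1]
  simp
  ring

theorem convex_nonneg {m : Type*} : Convex ℝ {J : Matrix m m ℂ | 0 ≤ J} :=
  fun _ h _ h' _ _ ha hb _ => add_nonneg (smul_nonneg_matrix ha h) (smul_nonneg_matrix hb h')

theorem convex_Icc_smul_one {n : Type*} [DecidableEq n] (t : ℝ) :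
    Convex ℝ {E : Matrix n n ℂ | -(t • (1 : Matrix n n ℂ)) ≤ E ∧ E ≤ t • (1 : Matrix n n ℂ)} := by
  rintro E ⟨h1, h2⟩ E' ⟨h3, h4⟩ a b ha hb hab
  have hs : t • (1 : Matrix n n ℂ) = a • t • (1 : Matrix n n ℂ) + b • t • (1 : Matrix n n ℂ) := by
    rw [← add_smul, hab, one_smul]
  constructor
  · rw [hs, ← sub_nonneg]
    have := add_nonneg (smul_nonneg_matrix ha (sub_nonneg.2 h1))
      (smul_nonneg_matrix hb (sub_nonneg.2 h3))
    convert this using 1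
    simp only [smul_sub, smul_neg]
    abel
  · rw [hs, ← sub_nonneg]
    have := add_nonneg (smul_nonneg_matrix ha (sub_nonneg.2 h2))
      (smul_nonneg_matrix hb (sub_nonneg.2 h4))
    convert this using 1
    simp only [smul_sub]
    abel

theorem choiMap_real_smul {n : Type*} [Fintype n] (r : ℝ) (J : Matrix (n × n) (n × n) ℂ)
    (Z : Matrix n n ℂ) : choiMap (r • J) Z = r • choiMap J Z := by
  rw [← Complex.coe_smul, map_smul, LinearMap.smul_apply, Complex.coe_smul]

variable {n X Y : Type*} [Fintype n] [DecidableEq n] [Fintype X] [Fintype Y]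

theorem isCompact_Icc_smul_one (t : ℝ) :
    IsCompact {E : Matrix n n ℂ | -(t • (1 : Matrix n n ℂ)) ≤ E ∧ E ≤ t • (1 : Matrix n n ℂ)} := by
  have h : {E : Matrix n n ℂ | -(t • (1 : Matrix n n ℂ)) ≤ E ∧ E ≤ t • (1 : Matrix n n ℂ)} =
      {E | 0 ≤ E - -(t • (1 : Matrix n n ℂ))} ∩ {E | 0 ≤ t • (1 : Matrix n n ℂ) - E} := by
    ext E
    simp only [Set.mem_ofPred_eq, Set.mem_inter_iff, sub_nonneg]
  refine IsCompact.of_isClosed_subset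
    ((isCompact_nonneg_trace_le (2 * t * Fintype.card n)).image
      (continuous_id.sub (continuous_const (y := t • (1 : Matrix n n ℂ))))) ?_ ?_
  · rw [h]
    exact (isClosed_nonneg.preimage (by fun_prop)).inter (isClosed_nonneg.preimage (by fun_prop))
  · rintro E ⟨h1, h2⟩
    refine ⟨E + t • 1, ⟨?_, ?_⟩, by simp⟩
    · simpa using sub_nonneg.2 h1
    · have h3 := trace_mul_le_trace_mul h2 PosSemidef.one.nonneg
      have h4 := (Complex.le_def.1 h3).1
      simp [trace_smul] at h4 ⊢
      linarith

/-- The sign of a selfadjoint matrix attains the trace norm. -/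
theorem exists_trace_mul_eq_trace_abs {K : Matrix n n ℂ} (hK : K.IsHermitian) :
    ∃ E : Matrix n n ℂ, -1 ≤ E ∧ E ≤ 1 ∧ K * E = CFC.abs K := by
  have hc : ∀ f : ℝ → ℝ, ContinuousOn f (spectrum ℝ K) := fun f =>
    (finite_real_spectrum (A := K)).continuousOn f
  let s : ℝ → ℝ := fun x => if 0 ≤ x then 1 else -1
  have hs : ∀ x, s x ≤ 1 ∧ -s x ≤ 1 := fun x => by
    simp only [s]
    split_ifs <;> norm_num
  refine ⟨cfc s K, ?_, cfc_le_one s K fun x _ => (hs x).1, ?_⟩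
  · have := cfc_le_one (fun x => -s x) K fun x _ => (hs x).2
    rw [cfc_neg] at this
    exact neg_le.1 this
  · have hK' : IsSelfAdjoint K := hK
    rw [CFC.abs_eq_cfc_norm K hK']
    have h1 := cfc_mul id s K (hc _) (hc _)
    rw [cfc_id ℝ K hK'] at h1
    rw [← h1]
    refine cfc_congr fun x _ => ?_
    simp only [id, s, Real.norm_eq_abs]
    split_ifs with h
    · rw [abs_of_nonneg h, mul_one]
    · rw [abs_of_neg (not_le.1 h), mul_neg_one]

theorem trace_abs_eq_ofReal (K : Matrix n n ℂ) :
    (((CFC.abs K).trace.re : ℝ) : ℂ) = (CFC.abs K).trace := by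
  simpa using trace_mul_eq_ofReal
    (nonneg_iff_posSemidef.1 (CFC.abs_nonneg K)).isHermitian (isHermitian_one (n := n))

theorem eq_zero_of_trace_abs_nonpos {K : Matrix n n ℂ} (h : (CFC.abs K).trace.re ≤ 0) : K = 0 := by
  have h1 := CFC.abs_mul_abs K
  rw [eq_zero_of_re_trace_nonpos (CFC.abs_nonneg K) h, zero_mul] at h1
  exact conjTranspose_mul_self_eq_zero.1 h1.symm

/-- The families `(I_x^*(1))_x` and `(I^*(B_y) + E_y)_y` as a function of the Choi matrices of `I_x`
and of the errors `E_y`. -/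
def outcomeMap (B : Observable n Y) :
    (X → Matrix (n × n) (n × n) ℂ) × (Y → Matrix n n ℂ) →ₗ[ℝ]
      (X → Matrix n n ℂ) × (Y → Matrix n n ℂ) where
  toFun p := (fun x => choiMap (p.1 x) 1, fun y => ∑ x, choiMap (p.1 x) (B.effect y) + p.2 y)
  map_add' p q := by
    refine Prod.ext (funext fun x => by simp) (funext fun y => ?_)
    simp only [Prod.fst_add, Prod.snd_add, Pi.add_apply, map_add, LinearMap.add_apply,
      Finset.sum_add_distrib]
    abel
  map_smul' r p := by
    refine Prod.ext (funext fun x => choiMap_real_smul r _ _) (funext fun y => ?_)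
    simp only [Prod.smul_fst, Prod.smul_snd, Pi.smul_apply, choiMap_real_smul, RingHom.id_apply,
      smul_add, Finset.smul_sum]

/-- The families `(A_x)_x`, `(B'_y)_y` that arise as `A_x = I_x^*(1)` and `B'_y = I^*(B_y) + E_y`
from completely positive `I_x` and errors `-t ≤ E_y ≤ t`. -/
def reachable (B : Observable n Y) (t : ℝ) :
    Set ((X → Matrix n n ℂ) × (Y → Matrix n n ℂ)) :=
  outcomeMap B '' ((Set.univ.pi fun _ => {J | 0 ≤ J}) ×ˢ (Set.univ.pi fun _ =>
    {E | -(t • (1 : Matrix n n ℂ)) ≤ E ∧ E ≤ t • (1 : Matrix n n ℂ)}))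

theorem convex_reachable (B : Observable n Y) (t : ℝ) :
    Convex ℝ (reachable B t : Set ((X → Matrix n n ℂ) × (Y → Matrix n n ℂ))) := by
  refine Convex.linear_image (Convex.prod ?_ ?_) (outcomeMap B)
  · exact convex_pi fun _ _ => convex_nonneg
  · exact convex_pi fun _ _ => convex_Icc_smul_one t

/-- As `tr J_x = tr I_x^*(1)`, bounded parts of the reachable set come from compact sets of Choi
matrices. -/
theorem isClosed_reachable (B : Observable n Y) (t : ℝ) :
    IsClosed (reachable B t : Set ((X → Matrix n n ℂ) × (Y → Matrix n n ℂ))) := by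
  refine isClosed_of_closure_subset fun p hp => ?_
  let U : Set ((X → Matrix n n ℂ) × (Y → Matrix n n ℂ)) :=
    ⋂ x, {q | (q.1 x).trace.re < (p.1 x).trace.re + 1}
  have hU : IsOpen U := isOpen_iInter_of_finite fun x =>
    isOpen_lt (Complex.continuous_re.comp ((continuous_apply x).comp continuous_fst).matrix_trace)
      continuous_const
  have hpU : p ∈ U := Set.mem_iInter.2 fun x => by simp
  have hp' : p ∈ closure (U ∩ reachable B t) := hU.inter_closure ⟨hpU, hp⟩
  let S : Set ((X → Matrix (n × n) (n × n) ℂ) × (Y → Matrix n n ℂ)) :=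
    (Set.univ.pi fun x => {J | 0 ≤ J ∧ J.trace.re ≤ (p.1 x).trace.re + 1}) ×ˢ
      (Set.univ.pi fun _ => {E | -(t • (1 : Matrix n n ℂ)) ≤ E ∧ E ≤ t • (1 : Matrix n n ℂ)})
  have hS : IsCompact S := (isCompact_univ_pi fun x => isCompact_nonneg_trace_le _).prod
    (isCompact_univ_pi fun _ => isCompact_Icc_smul_one t)
  have hK := hS.image (outcomeMap (X := X) B).continuous_of_finiteDimensional
  have hsub : U ∩ reachable B t ⊆ outcomeMap B '' S := by
    rintro q ⟨hqU, ⟨J, E⟩, ⟨hJ, hE⟩, rfl⟩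
    refine Set.mem_image_of_mem _ ⟨fun x _ => ⟨hJ x trivial, ?_⟩, hE⟩
    have h1 : (choiMap (J x) 1).trace.re < (p.1 x).trace.re + 1 := Set.mem_iInter.1 hqU x
    rw [trace_choiMap_one] at h1
    exact h1.le
  obtain ⟨⟨J, E⟩, ⟨hJ, hE⟩, h⟩ := closure_minimal hsub hK.isClosed hp'
  exact ⟨(J, E), ⟨fun x _ => (hJ x trivial).1, hE⟩, h⟩

theorem mem_reachable_iff (A : Observable n X) (B : Observable n Y) (t : ℝ) :
    (A.effect, B.effect) ∈ reachable (X := X) B t ↔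
      ∃ I : Instrument n X, I.Implements A ∧ I.DisturbsAtMost B t := by
  rw [exists_disturbsAtMost_iff]
  constructor
  · rintro ⟨⟨J, E⟩, ⟨hJ, hE⟩, h⟩
    obtain ⟨hA, hB⟩ := Prod.mk.inj h
    refine ⟨J, fun x => hJ x trivial, congrFun hA, fun y => ?_⟩
    have h1 : B.effect y - ∑ x, choiMap (J x) (B.effect y) = E y := by
      rw [sub_eq_iff_eq_add']
      exact (congrFun hB y).symm
    rw [h1]
    exact hE y trivial
  · rintro ⟨J, hJ, hA, hB⟩
    exact ⟨(J, fun y => B.effect y - ∑ x, choiMap (J x) (B.effect y)),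
      ⟨fun x _ => hJ x, fun y _ => hB y⟩,
      Prod.ext (funext hA) (funext fun y => add_sub_cancel _ _)⟩

theorem re_trace_mul_sum_choiMap (B : Observable n Y) (K : Y → Matrix n n ℂ)
    (J : Matrix (n × n) (n × n) ℂ) :
    ∑ y, (K y * choiMap J (B.effect y)).trace =
      ((∑ y, K y ⊗ₖ (B.effect y)ᵀ) * J).trace := by
  simp only [trace_mul_choiMap, Finset.sum_mul, trace_sum]

theorem isHermitian_sum_kronecker (B : Observable n Y) {K : Y → Matrix n n ℂ}
    (hK : ∀ y, (K y).IsHermitian) : (∑ y, K y ⊗ₖ (B.effect y)ᵀ).IsHermitian :=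
  isSelfAdjoint_sum _ fun y _ => by
    have h : ((B.effect y)ᵀ).IsHermitian := (B.isHermitian y).transpose
    simp only [IsSelfAdjoint, star_eq_conjTranspose, conjTranspose_kronecker, (hK y).eq, h.eq]

theorem dualObjective_eq (A : Observable n X) (B : Observable n Y)
    (H : X → Matrix n n ℂ) (K : Y → Matrix n n ℂ) :
    dualObjective A B H K =
      ∑ x, (H x * A.effect x).trace.re - ∑ y, (K y * B.effect y).trace.re := by
  simp [dualObjective]

/-- A disturbance that no instrument achieves is separated from the reachable ones by a dual
certificate, by the Hahn–Banach theorem. -/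
theorem exists_separating {A : Observable n X} {B : Observable n Y} {t : ℝ} (ht : 0 ≤ t)
    (h : ¬ ∃ I : Instrument n X, I.Implements A ∧ I.DisturbsAtMost B t) :
    ∃ (H : X → Matrix n n ℂ) (K : Y → Matrix n n ℂ), (∀ x, (H x).IsHermitian) ∧
      (∀ y, (K y).IsHermitian) ∧
      (∀ x, H x ⊗ₖ (1 : Matrix n n ℂ) ≤ ∑ y, K y ⊗ₖ (B.effect y)ᵀ) ∧
      t * ∑ y, (CFC.abs (K y)).trace.re < dualObjective A B H K := by
  classical
  have : LocallyConvexSpace ℝ (Matrix n n ℂ) :=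
    inferInstanceAs (LocallyConvexSpace ℝ (n → n → ℂ))
  rw [← mem_reachable_iff] at h
  obtain ⟨f, u, hf, hu⟩ := RCLike.geometric_hahn_banach_closed_point (𝕜 := ℂ)
    (convex_reachable B t) (isClosed_reachable B t) h
  -- the components of the functional are the selfadjoint matrices `H_x` and `-K_y`
  choose H hH hfH using fun x => exists_isHermitian_re_eq
    (f.toLinearMap ∘ₗ LinearMap.inl ℂ _ _ ∘ₗ LinearMap.single ℂ (fun _ : X => Matrix n n ℂ) x)
  choose K hK hfK using fun y => exists_isHermitian_re_eq
    (-(f.toLinearMap ∘ₗ LinearMap.inr ℂ _ _ ∘ₗ LinearMap.single ℂ (fun _ : Y => Matrix n n ℂ) y))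
  have hfPQ : ∀ (P : X → Matrix n n ℂ) (Q : Y → Matrix n n ℂ), (∀ x, (P x).IsHermitian) →
      (∀ y, (Q y).IsHermitian) →
      (f (P, Q)).re = ∑ x, (H x * P x).trace.re - ∑ y, (K y * Q y).trace.re := by
    intro P Q hP hQ
    have hsplit : (P, Q) = ∑ x, ((Pi.single x (P x), 0) : (X → Matrix n n ℂ) × (Y → Matrix n n ℂ))
        + ∑ y, (0, Pi.single y (Q y)) := by
      rw [← Finset.univ_sum_single P, ← Finset.univ_sum_single Q]
      refine Prod.ext ?_ ?_ <;> simp [Prod.fst_sum, Prod.snd_sum]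
    rw [hsplit, map_add, map_sum, map_sum, Complex.add_re, Complex.re_sum, Complex.re_sum,
      sub_eq_add_neg, ← Finset.sum_neg_distrib]
    refine congrArg₂ (· + ·) (Finset.sum_congr rfl fun x _ => ?_)
      (Finset.sum_congr rfl fun y _ => ?_)
    · rw [← hfH x _ (hP x)]
      rfl
    · rw [← hfK y _ (hQ y)]
      simp
  -- the values of the functional on the reachable set
  have hval : ∀ (J : X → Matrix (n × n) (n × n) ℂ) (E : Y → Matrix n n ℂ), (∀ x, 0 ≤ J x) →
      (∀ y, -(t • (1 : Matrix n n ℂ)) ≤ E y ∧ E y ≤ t • (1 : Matrix n n ℂ)) →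
      ∑ x, ((H x ⊗ₖ (1 : Matrix n n ℂ) - ∑ y, K y ⊗ₖ (B.effect y)ᵀ) * J x).trace.re -
        ∑ y, (K y * E y).trace.re < u := by
    intro J E hJ hE
    have h1 : RCLike.re (f (fun x => choiMap (J x) 1,
        fun y => ∑ x, choiMap (J x) (B.effect y) + E y)) < u :=
      hf _ ⟨(J, E), ⟨fun x _ => hJ x, fun y _ => hE y⟩, rfl⟩
    have hJh := fun x => (nonneg_iff_posSemidef.1 (hJ x)).isHermitian
    have hEh : ∀ y, (E y).IsHermitian := fun y => by
      have := (nonneg_iff_posSemidef.1 (sub_nonneg.2 (hE y).2)).isHermitian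
      have h2 := (isHermitian_real_smul (isHermitian_one (n := n) (α := ℂ)) t).sub this
      simpa using h2
    rw [RCLike.re_eq_complex_re, hfPQ _ _ (fun x => choiMap_isHermitian (hJh x) isHermitian_one)
      (fun y => (isSelfAdjoint_sum _ fun x _ =>
        choiMap_isHermitian (hJh x) (B.isHermitian y)).add (hEh y))] at h1
    refine lt_of_eq_of_lt ?_ h1
    simp only [sub_mul, trace_sub, ← re_trace_mul_sum_choiMap, mul_add, trace_add, Finset.mul_sum,
      trace_sum, trace_mul_choiMap, Complex.sub_re, Complex.add_re, Complex.re_sum,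
      Finset.sum_sub_distrib, Finset.sum_add_distrib, transpose_one]
    rw [Finset.sum_comm (s := (Finset.univ : Finset X))]
    ring
  have hzero : -(t • (1 : Matrix n n ℂ)) ≤ 0 ∧ 0 ≤ t • (1 : Matrix n n ℂ) := by
    have := smul_nonneg_matrix ht (PosSemidef.one (n := n) (R := ℂ)).nonneg
    exact ⟨neg_nonpos.2 this, this⟩
  refine ⟨H, K, hH, hK, fun x => ?_, ?_⟩
  · have hG := isHermitian_sum_kronecker B hK
    have hH1 : (H x ⊗ₖ (1 : Matrix n n ℂ)).IsHermitian := by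
      simp only [IsHermitian, conjTranspose_kronecker, (hH x).eq, conjTranspose_one]
    refine sub_nonneg.1 (nonneg_of_re_trace_mul_nonneg (hG.sub hH1) fun P hP => ?_)
    by_contra! hneg
    rw [← neg_sub, Matrix.neg_mul, trace_neg, Complex.neg_re, neg_lt_zero] at hneg
    -- the functional is unbounded along the ray through `P`
    set w := ((H x ⊗ₖ (1 : Matrix n n ℂ) - ∑ y, K y ⊗ₖ (B.effect y)ᵀ) * P).trace.re with hw
    have h1 := hval (Pi.single x ((|u| / w) • P)) 0 (fun x' => by
      rcases eq_or_ne x' x with rfl | hx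
      · simpa using smul_nonneg_matrix (by positivity) hP
      · simp [hx]) (fun y => hzero)
    rw [Finset.sum_eq_single x (fun x' _ hx => by simp [hx]) (by simp)] at h1
    simp [← hw] at h1
    rw [div_mul_cancel₀ _ hneg.ne'] at h1
    exact absurd (le_abs_self u) (not_le.2 h1)
  · -- evaluate at `J = 0` and `E_y = -t sgn (K_y)`
    choose E hE1 hE2 hE using fun y => exists_trace_mul_eq_trace_abs (hK y)
    have h1 := hval 0 (fun y => -(t • E y)) (fun x => le_rfl) (fun y => by
      have h1 := smul_nonneg_matrix ht (sub_nonneg.2 (hE1 y))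
      have h2 := smul_nonneg_matrix ht (sub_nonneg.2 (hE2 y))
      rw [smul_sub, sub_nonneg] at h1 h2
      exact ⟨neg_le_neg h2, by simpa using neg_le_neg h1⟩)
    rw [RCLike.re_eq_complex_re, hfPQ _ _ A.isHermitian B.isHermitian] at hu
    rw [dualObjective_eq]
    refine lt_of_eq_of_lt ?_ (h1.trans hu)
    simp [hE, Finset.mul_sum]

variable [Nonempty n]

/-- Strong duality: every number below the minimal disturbance is exceeded by a dual value. -/
theorem exists_isDualFeasible_lt {A : Observable n X} {B : Observable n Y} {t : ℝ} (ht : 0 ≤ t)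
    (htD : t < disturbance A B) :
    ∃ (H : X → Matrix n n ℂ) (K : Y → Matrix n n ℂ),
      IsDualFeasible B H K ∧ t < dualObjective A B H K := by
  have hD := isLeast_disturbance A B
  obtain ⟨H, K, hH, hK, hle, hobj⟩ := exists_separating ht fun hI =>
    htD.not_ge (hD.2 ⟨⟨ht, htD.le.trans hD.1.1.2⟩, hI⟩)
  -- dividing by `κ` normalizes the trace norm of `K`
  set κ := ∑ y, (CFC.abs (K y)).trace.re with hκ
  have habs : ∀ y, 0 ≤ (CFC.abs (K y)).trace.re := fun y =>
    (Complex.nonneg_iff.1 (nonneg_iff_posSemidef.1 (CFC.abs_nonneg (K y))).trace_nonneg).1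
  have hκ0 : 0 < κ := by
    refine lt_of_le_of_ne (Finset.sum_nonneg fun y _ => habs y) fun h0 => ?_
    -- `K = 0` would force `H_x ≤ 0` and hence a nonpositive objective
    have hK0 : ∀ y, K y = 0 := fun y => eq_zero_of_trace_abs_nonpos
      (((Finset.sum_eq_zero_iff_of_nonneg fun y _ => habs y).1 h0.symm y (Finset.mem_univ y)).le)
    rw [← h0, mul_zero, dualObjective_eq] at hobj
    refine hobj.not_ge ?_
    simp only [hK0, zero_mul, trace_zero, Complex.zero_re, Finset.sum_const_zero, sub_zero]
    refine Finset.sum_nonpos fun x _ => ?_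
    have h1 := hle x
    simp only [hK0, zero_kronecker, Finset.sum_const_zero] at h1
    have h2 := trace_mul_le_trace_mul h1
      ((nonneg_iff_posSemidef.1 (A.nonneg x)).kronecker PosSemidef.one).nonneg
    rw [← mul_kronecker_mul, trace_kronecker, zero_mul, trace_zero] at h2
    have h3 := (Complex.le_def.1 h2).1
    simp only [mul_one, trace_one, Complex.mul_re, Complex.natCast_re, Complex.natCast_im,
      mul_zero, sub_zero, Complex.zero_re] at h3
    exact nonpos_of_mul_nonpos_left h3 (by exact_mod_cast Fintype.card_pos)
  refine ⟨fun x => κ⁻¹ • H x, fun y => κ⁻¹ • K y, ⟨fun x => isHermitian_real_smul (hH x) _,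
    fun y => isHermitian_real_smul (hK y) _, fun x => ?_, ?_⟩, ?_⟩
  · have h1 := smul_nonneg_matrix (inv_nonneg.2 hκ0.le) (sub_nonneg.2 (hle x))
    rw [smul_sub, sub_nonneg, Finset.smul_sum] at h1
    simpa only [smul_kronecker] using h1
  · have h1 : ∀ y, (CFC.abs (κ⁻¹ • K y)).trace = ((κ⁻¹ * (CFC.abs (K y)).trace.re : ℝ) : ℂ) := by
      intro y
      rw [CFC.abs_smul, trace_smul, Real.norm_of_nonneg (inv_nonneg.2 hκ0.le), Complex.real_smul,
        Complex.ofReal_mul, trace_abs_eq_ofReal]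
    simp only [h1]
    rw [← Complex.ofReal_sum, ← Finset.mul_sum, ← hκ, inv_mul_cancel₀ hκ0.ne', Complex.ofReal_one]
  · rw [dualObjective_eq] at hobj ⊢
    simp only [smul_mul, trace_smul, Complex.smul_re, smul_eq_mul, ← Finset.mul_sum, ← mul_sub]
    rwa [lt_inv_mul_iff₀ hκ0, mul_comm]

end StrongDuality

/-! ### Selfadjoint operator bases -/

namespace OperatorBasis

section Existence

variable {n : Type*} [Fintype n]

/-- The real-linear isometry from real matrices, with the Euclidean norm, onto selfadjoint matrices
whose real part is the symmetric part and whose imaginary part is the antisymmetric part. -/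
noncomputable def symmAntisymm (v : EuclideanSpace ℝ (n × n)) : Matrix n n ℂ :=
  Matrix.of fun i j => ⟨(v (i, j) + v (j, i)) / 2, (v (i, j) - v (j, i)) / 2⟩

omit [Fintype n] in
theorem symmAntisymm_isHermitian (v : EuclideanSpace ℝ (n × n)) :
    (symmAntisymm v).IsHermitian := by
  ext i j
  refine Complex.ext ?_ ?_ <;> simp [symmAntisymm] <;> ring

theorem trace_symmAntisymm_mul (v w : EuclideanSpace ℝ (n × n)) :
    (symmAntisymm v * symmAntisymm w).trace = (inner ℝ v w : ℝ) := by
  rw [← trace_mul_eq_ofReal (symmAntisymm_isHermitian v) (symmAntisymm_isHermitian w)]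
  congr 1
  have h1 : ∑ i, ∑ j, v (j, i) * w (j, i) = ∑ i, ∑ j, v (i, j) * w (i, j) := Finset.sum_comm
  have h2 : (symmAntisymm v * symmAntisymm w).trace.re =
      ∑ i, ∑ j, (v (i, j) * w (i, j) / 2 + v (j, i) * w (j, i) / 2) := by
    simp only [trace, diag_apply, mul_apply, Complex.re_sum, symmAntisymm, of_apply, Complex.mul_re]
    exact Finset.sum_congr rfl fun i _ => Finset.sum_congr rfl fun j _ => by ring
  rw [h2]
  simp only [Finset.sum_add_distrib, ← Finset.sum_div, h1, PiLp.inner_apply,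
    Fintype.sum_prod_type, RCLike.inner_apply, conj_trivial]
  rw [add_halves]
  exact Finset.sum_congr rfl fun i _ => Finset.sum_congr rfl fun j _ => mul_comm _ _

variable [DecidableEq n] [Nonempty n]

theorem nonempty : Nonempty (OperatorBasis n (Fin (Fintype.card n ^ 2))) := by
  have hd : (0 : ℝ) < Fintype.card n := by exact_mod_cast Fintype.card_pos
  let z : Fin (Fintype.card n ^ 2) := ⟨0, pow_pos Fintype.card_pos 2⟩
  -- `v` corresponds to `1 / √d`; extend it to an orthonormal basis of real matrices
  let v : EuclideanSpace ℝ (n × n) :=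
    WithLp.toLp 2 fun p => if p.1 = p.2 then 1 / Real.sqrt (Fintype.card n) else 0
  have hv : symmAntisymm v = (1 / Real.sqrt (Fintype.card n)) • (1 : Matrix n n ℂ) := by
    ext i j
    rcases eq_or_ne i j with rfl | hij
    · refine Complex.ext ?_ ?_ <;>
        simp only [symmAntisymm, v, of_apply, if_true, Matrix.smul_apply, one_apply_eq,
          Complex.smul_re, Complex.smul_im, Complex.one_re, Complex.one_im, add_self_div_two,
          sub_self, zero_div, mul_zero, smul_eq_mul, mul_one]
    · refine Complex.ext ?_ ?_ <;> simp [symmAntisymm, v, hij, hij.symm]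
  have hnorm : ‖v‖ = 1 := by
    have h1 := trace_symmAntisymm_mul v v
    rw [hv, real_inner_self_eq_norm_sq] at h1
    have h2 := congrArg Complex.re h1
    rw [smul_mul, Matrix.one_mul, trace_smul, trace_smul, trace_one, smul_smul, ← mul_div_mul_comm,
      Real.mul_self_sqrt hd.le, Complex.smul_re, Complex.ofReal_re, Complex.natCast_re, mul_one,
      smul_eq_mul, one_div, inv_mul_cancel₀ hd.ne'] at h2
    exact (pow_eq_one_iff_of_nonneg (norm_nonneg v) two_ne_zero).1 h2.symm
  obtain ⟨b, hb⟩ := Orthonormal.exists_orthonormalBasis_extension_of_card_eq (𝕜 := ℝ)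
    (E := EuclideanSpace ℝ (n × n)) (ι := Fin (Fintype.card n ^ 2)) (by simp [sq])
    (v := fun _ => v) (s := {z})
    ⟨fun _ => hnorm, fun i j hij => absurd (Subsingleton.elim i j) hij⟩
  have htr : ∀ i j, (symmAntisymm (b i) * symmAntisymm (b j)).trace =
      ((if i = j then 1 else 0 : ℝ) : ℂ) := fun i j => by
    rw [trace_symmAntisymm_mul, orthonormal_iff_ite.1 b.orthonormal]
  refine ⟨⟨fun i => symmAntisymm (b i), z, fun i => symmAntisymm_isHermitian _, fun i => ?_,
    fun i j hij => ?_, ?_, ?_⟩⟩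
  · simp [htr]
  · simp [htr, hij]
  · refine LinearIndependent.span_eq_top_of_card_eq_finrank' ?_
      (by simp [sq, Module.finrank_matrix])
    refine Fintype.linearIndependent_iff.2 fun g hg i => ?_
    have h1 := congrArg (fun M => (M * symmAntisymm (b i)).trace) hg
    simpa [Finset.sum_mul, trace_sum, trace_smul, htr, apply_ite] using h1
  · rw [hb z rfl, hv]

end Existence

section Expansion

variable {n κ : Type*} [Fintype n] [DecidableEq n] [Fintype κ] [DecidableEq κ]
  (e : OperatorBasis n κ)

omit [Fintype κ] in
theorem trace_mul (i j : κ) : (e.E i * e.E j).trace = if i = j then 1 else 0 := by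
  split_ifs with h
  · rw [h, e.trace_self]
  · exact e.trace_ne i j h

theorem sum_trace_smul (M : Matrix n n ℂ) : ∑ j, (e.E j * M).trace • e.E j = M := by
  let f : Matrix n n ℂ →ₗ[ℂ] Matrix n n ℂ :=
    ∑ j, ((traceLinearMap n ℂ ℂ).comp (LinearMap.mulLeft ℂ (e.E j))).smulRight (e.E j)
  have hf : f = LinearMap.id := by
    refine LinearMap.ext_on e.span_eq_top ?_
    rintro _ ⟨i, rfl⟩
    simp [f, trace_mul]
  simpa [f] using LinearMap.congr_fun hf M

variable [Nonempty n]

omit [DecidableEq n] in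
theorem sqrt_card_pos : 0 < Real.sqrt (Fintype.card n) :=
  Real.sqrt_pos.2 (by exact_mod_cast Fintype.card_pos)

omit [Fintype κ] [DecidableEq κ] in
theorem sqrt_smul_E_zero : Real.sqrt (Fintype.card n) • e.E e.zero = 1 := by
  rw [e.E_zero, smul_smul, mul_one_div_cancel (sqrt_card_pos (n := n)).ne', one_smul]

omit [Fintype κ] in
theorem trace_E (i : κ) :
    (e.E i).trace = if i = e.zero then ((Real.sqrt (Fintype.card n) : ℝ) : ℂ) else 0 := by
  rw [← Matrix.mul_one (e.E i), ← e.sqrt_smul_E_zero, Matrix.mul_smul, trace_smul, e.trace_mul]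
  split_ifs <;> simp

/-- The Choi matrix with coefficients `c i j` with respect to the basis `E_j ⊗ E_iᵀ`. -/
noncomputable def choi (c : κ → κ → ℝ) : Matrix (n × n) (n × n) ℂ :=
  ∑ i, ∑ j, c i j • (e.E j ⊗ₖ (e.E i)ᵀ)

omit [DecidableEq κ] [Nonempty n] in
theorem choiMap_choi (c : κ → κ → ℝ) (Z : Matrix n n ℂ) :
    choiMap (e.choi c) Z = ∑ i, ∑ j, c i j • (e.E i * Z).trace • e.E j := by
  simp only [choi, map_sum, LinearMap.sum_apply, choiMap_real_smul, choiMap_kronecker,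
    transpose_transpose]

theorem choiMap_choi_one (c : κ → κ → ℝ) :
    choiMap (e.choi c) 1 = Real.sqrt (Fintype.card n) • ∑ j, c e.zero j • e.E j := by
  simp only [choiMap_choi, mul_one, trace_E, ite_smul, zero_smul, smul_ite, smul_zero,
    Complex.coe_smul, Finset.smul_sum]
  rw [Finset.sum_eq_single e.zero (fun i _ hi => by simp [hi]) (by simp)]
  exact Finset.sum_congr rfl fun j _ => by rw [if_pos rfl, smul_comm]

omit [Nonempty n] in
theorem trace_mul_choiMap_choi (c : κ → κ → ℝ) (i j : κ) :
    (e.E j * choiMap (e.choi c) (e.E i)).trace = c i j := by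
  rw [choiMap_choi]
  simp only [Finset.mul_sum, trace_sum, Matrix.mul_smul, trace_smul]
  simp [e.trace_mul]

omit [Nonempty n] in
theorem eq_choi {c : κ → κ → ℝ} {J : Matrix (n × n) (n × n) ℂ}
    (h : ∀ i j, (e.E j * choiMap J (e.E i)).trace = c i j) : J = e.choi c := by
  refine choiMap_injective (LinearMap.ext_on e.span_eq_top ?_)
  rintro _ ⟨i, rfl⟩
  rw [← e.sum_trace_smul (choiMap J (e.E i)), ← e.sum_trace_smul (choiMap (e.choi c) (e.E i))]
  simp only [h, trace_mul_choiMap_choi]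

omit [Nonempty n] in
/-- Parseval's identity for the basis `E_j ⊗ E_iᵀ`. -/
theorem trace_choi_mul_self (c : κ → κ → ℝ) :
    (e.choi c * e.choi c).trace = ((∑ i, ∑ j, c i j ^ 2 : ℝ) : ℂ) := by
  conv_lhs => enter [1, 1]; rw [choi]
  simp only [Finset.sum_mul, trace_sum, smul_mul, trace_smul, ← trace_mul_choiMap,
    trace_mul_choiMap_choi, Complex.ofReal_sum]
  simp [sq]

omit [DecidableEq κ] [Fintype κ] [Nonempty n] in
theorem trace_mul_choiMap_eq_ofReal {J : Matrix (n × n) (n × n) ℂ} (hJ : 0 ≤ J) (i j : κ) :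
    (((e.E j * choiMap J (e.E i)).trace.re : ℝ) : ℂ) = (e.E j * choiMap J (e.E i)).trace :=
  trace_mul_eq_ofReal (e.herm j)
    (choiMap_isHermitian (nonneg_iff_posSemidef.1 hJ).isHermitian (e.herm i))

end Expansion

end OperatorBasis

/-! ### Direct sums -/

section DirectSum

theorem blockDiagonal_nonneg_iff {m o : Type*} [Fintype m] [Fintype o] [DecidableEq o]
    {P : o → Matrix m m ℂ} : 0 ≤ blockDiagonal P ↔ ∀ k, 0 ≤ P k := by
  constructor
  · intro h k
    convert ((nonneg_iff_posSemidef.1 h).submatrix fun i => (i, k)).nonneg using 1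
    ext i j
    simp [blockDiagonal_apply]
  · intro h
    classical
    choose R hR using fun k => CStarAlgebra.nonneg_iff_eq_star_mul_self.1 (h k)
    have : blockDiagonal P = star (blockDiagonal R) * blockDiagonal R := by
      rw [star_eq_conjTranspose, blockDiagonal_conjTranspose, ← blockDiagonal_mul]
      exact congrArg _ (funext hR)
    rw [this]
    exact star_mul_self_nonneg _

theorem fromBlocks_zero_nonneg_iff {l m : Type*} [Fintype l] [Fintype m]
    {P : Matrix l l ℂ} {Q : Matrix m m ℂ} : 0 ≤ fromBlocks P 0 0 Q ↔ 0 ≤ P ∧ 0 ≤ Q := by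
  constructor
  · intro h
    exact ⟨((nonneg_iff_posSemidef.1 h).submatrix Sum.inl).nonneg,
      ((nonneg_iff_posSemidef.1 h).submatrix Sum.inr).nonneg⟩
  · rintro ⟨hP, hQ⟩
    classical
    obtain ⟨R, rfl⟩ := CStarAlgebra.nonneg_iff_eq_star_mul_self.1 hP
    obtain ⟨S, rfl⟩ := CStarAlgebra.nonneg_iff_eq_star_mul_self.1 hQ
    have : fromBlocks (star R * R) 0 0 (star S * S) =
        star (fromBlocks R 0 0 S) * fromBlocks R 0 0 S := by
      simp [star_eq_conjTranspose, fromBlocks_conjTranspose, fromBlocks_multiply]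
    rw [this]
    exact star_mul_self_nonneg _

theorem trace_fromBlocks_zero {l m : Type*} [Fintype l] [Fintype m]
    (P : Matrix l l ℂ) (Q : Matrix m m ℂ) : (fromBlocks P 0 0 Q).trace = P.trace + Q.trace := by
  simp [trace, Fintype.sum_sum_type]

variable {n X Y : Type*} [DecidableEq X] [DecidableEq Y]

theorem directSum_sub (P P' : Bool × X → Matrix n n ℂ) (Q Q' : X → Matrix (n × n) (n × n) ℂ)
    (S S' : Bool × Y → Matrix n n ℂ) :
    directSum P Q S - directSum P' Q' S' =
      directSum (fun p => P p - P' p) (fun x => Q x - Q' x) fun p => S p - S' p := by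
  ext (i | i | i) (j | j | j) <;> simp [directSum, blockDiagonal_apply] <;> split_ifs <;> simp

theorem directSum_smul (r : ℝ) (P : Bool × X → Matrix n n ℂ) (Q : X → Matrix (n × n) (n × n) ℂ)
    (S : Bool × Y → Matrix n n ℂ) :
    r • directSum P Q S =
      directSum (fun p => r • P p) (fun x => r • Q x) fun p => r • S p := by
  ext (i | i | i) (j | j | j) <;> simp [directSum, blockDiagonal_apply]

theorem directSum_add (P P' : Bool × X → Matrix n n ℂ) (Q Q' : X → Matrix (n × n) (n × n) ℂ)
    (S S' : Bool × Y → Matrix n n ℂ) :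
    directSum P Q S + directSum P' Q' S' =
      directSum (fun p => P p + P' p) (fun x => Q x + Q' x) fun p => S p + S' p := by
  ext (i | i | i) (j | j | j) <;> simp [directSum, blockDiagonal_apply] <;> split_ifs <;> simp

theorem directSum_sum {ι : Type*} (s : Finset ι) (P : ι → Bool × X → Matrix n n ℂ)
    (Q : ι → X → Matrix (n × n) (n × n) ℂ) (S : ι → Bool × Y → Matrix n n ℂ) :
    ∑ l ∈ s, directSum (P l) (Q l) (S l) =
      directSum (fun p => ∑ l ∈ s, P l p) (fun x => ∑ l ∈ s, Q l x) fun p => ∑ l ∈ s, S l p := by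
  ext (i | i | i) (j | j | j) <;>
    simp [directSum, blockDiagonal_apply, Matrix.sum_apply]

theorem directSum_one [DecidableEq n] (r : ℝ) :
    directSum (fun _ : Bool × X => r • (1 : Matrix n n ℂ)) (fun _ => r • 1)
      (fun _ : Bool × Y => r • 1) = r • 1 := by
  have h : (directSum (fun _ : Bool × X => (1 : Matrix n n ℂ)) (fun _ => 1)
      (fun _ : Bool × Y => 1)) = 1 := by
    simp only [directSum]
    rw [show (fun _ : Bool × X => (1 : Matrix n n ℂ)) = 1 from rfl,
      show (fun _ : X => (1 : Matrix (n × n) (n × n) ℂ)) = 1 from rfl,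
      show (fun _ : Bool × Y => (1 : Matrix n n ℂ)) = 1 from rfl]
    simp only [blockDiagonal_one, fromBlocks_one]
  rw [← h, directSum_smul]

variable [Fintype n] [Fintype X] [Fintype Y]

theorem directSum_nonneg_iff {P : Bool × X → Matrix n n ℂ} {Q : X → Matrix (n × n) (n × n) ℂ}
    {S : Bool × Y → Matrix n n ℂ} :
    0 ≤ directSum P Q S ↔ (∀ p, 0 ≤ P p) ∧ (∀ x, 0 ≤ Q x) ∧ ∀ p, 0 ≤ S p := by
  simp only [directSum, fromBlocks_zero_nonneg_iff, blockDiagonal_nonneg_iff]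

theorem trace_directSum_mul (P P' : Bool × X → Matrix n n ℂ) (Q Q' : X → Matrix (n × n) (n × n) ℂ)
    (S S' : Bool × Y → Matrix n n ℂ) :
    (directSum P Q S * directSum P' Q' S').trace =
      ∑ p, (P p * P' p).trace + (∑ x, (Q x * Q' x).trace + ∑ p, (S p * S' p).trace) := by
  simp [directSum, fromBlocks_multiply, trace_fromBlocks_zero, ← blockDiagonal_mul,
    trace_blockDiagonal]

end DirectSum

/-! ### Feasible points of the program -/

namespace SDP

variable {V R : Type*} [Fintype V] [Fintype R]

/-- Weak duality. -/
theorem dual_le_objective (P : SDP V R) {c : V → ℝ} (hc : P.Feasible c) {C : Matrix R R ℂ}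
    (hC : P.DualFeasible C) : (P.F₀ * C).trace.re ≤ P.objective c := by
  have h := (Complex.le_def.1 (trace_mul_le_trace_mul hc hC.1)).1
  simp only [Finset.sum_mul, smul_mul, trace_sum, trace_smul, hC.2, Complex.re_sum,
    Complex.smul_re, Complex.ofReal_re, smul_eq_mul] at h
  simpa only [objective, mul_comm] using h

end SDP

section Program

variable {n X Y κ : Type*} [Fintype n] [DecidableEq n] [Fintype X] [DecidableEq X]
  [Fintype Y] [DecidableEq Y] [Fintype κ] [DecidableEq κ]

/-- The Choi matrix of `I_x` read off from a point of the program. -/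
noncomputable def pointChoi (e : OperatorBasis n κ) (c : Unit ⊕ X × κ × κ → ℝ) (x : X) :
    Matrix (n × n) (n × n) ℂ :=
  e.choi fun i j => c (Sum.inr (x, i, j))

omit [Fintype n] [DecidableEq n] in
theorem forall_nonneg_sgn_smul {M : Matrix n n ℂ} :
    (∀ b, 0 ≤ sgn b • M) ↔ M = 0 := by
  simp only [Bool.forall_bool, sgn, Bool.false_eq_true, if_false, if_true, neg_smul, one_smul,
    neg_nonneg]
  exact ⟨fun h => le_antisymm h.1 h.2, fun h => by simp [h]⟩

variable (A : Observable n X) (B : Observable n Y) (e : OperatorBasis n κ)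

theorem objective_disturbanceSDP (c : Unit ⊕ X × κ × κ → ℝ) :
    (disturbanceSDP A B e).objective c = c (Sum.inl ()) := by
  simp [SDP.objective, disturbanceSDP]

omit [DecidableEq Y] [Fintype κ] [DecidableEq κ] in
theorem re_trace_E_mul_smul (i : κ) (y : Y) (M : Matrix n n ℂ) :
    (e.E i * B.effect y).trace.re • M = (e.E i * B.effect y).trace • M := by
  rw [← Complex.coe_smul, trace_mul_eq_ofReal (e.herm i) (B.isHermitian y)]

variable [Nonempty n]

/-- The slack of a point of the program, in terms of the maps with Choi matrices `pointChoi`. -/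
theorem sum_smul_F_sub_F₀ (c : Unit ⊕ X × κ × κ → ℝ) :
    ∑ l, c l • (disturbanceSDP A B e).F l - (disturbanceSDP A B e).F₀ =
      directSum
        (fun p => sgn p.1 • (1 / Real.sqrt (Fintype.card n)) •
          (choiMap (pointChoi e c p.2) 1 - A.effect p.2))
        (pointChoi e c)
        (fun p => c (Sum.inl ()) • 1 + sgn p.1 •
          (∑ x, choiMap (pointChoi e c x) (B.effect p.2) - B.effect p.2)) := by
  have hs := (OperatorBasis.sqrt_card_pos (n := n)).ne'
  simp only [disturbanceSDP, Fintype.sum_sum_type, Sum.elim_inl, Sum.elim_inr, directSum_smul,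
    directSum_sum, directSum_add, directSum_sub]
  congr 1
  · funext ⟨b, x⟩
    simp only [pointChoi, e.choiMap_choi_one, smul_sub, smul_smul, one_div_mul_cancel hs, mul_one,
      Fintype.sum_prod_type]
    simp [ite_and, smul_smul, Finset.smul_sum, mul_comm]
  · funext x
    simp [Fintype.sum_prod_type, pointChoi, OperatorBasis.choi]
  · funext ⟨b, y⟩
    simp only [pointChoi, e.choiMap_choi, smul_sub, Fintype.sum_prod_type, e.sqrt_smul_E_zero,
      Finset.univ_unique, Finset.sum_singleton, Finset.smul_sum, add_sub_assoc,
      re_trace_E_mul_smul]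
    congr 2
    refine Finset.sum_congr rfl fun x _ => Finset.sum_congr rfl fun i _ =>
      Finset.sum_congr rfl fun j _ => ?_
    rw [smul_comm]

theorem feasible_iff (c : Unit ⊕ X × κ × κ → ℝ) :
    (disturbanceSDP A B e).Feasible c ↔ (∀ x, 0 ≤ pointChoi e c x) ∧
      (∀ x, choiMap (pointChoi e c x) 1 = A.effect x) ∧
      ∀ y, -(c (Sum.inl ()) • (1 : Matrix n n ℂ)) ≤
          B.effect y - ∑ x, choiMap (pointChoi e c x) (B.effect y) ∧
        B.effect y - ∑ x, choiMap (pointChoi e c x) (B.effect y) ≤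
          c (Sum.inl ()) • (1 : Matrix n n ℂ) := by
  have hs : 1 / Real.sqrt (Fintype.card n) ≠ 0 :=
    one_div_ne_zero (OperatorBasis.sqrt_card_pos (n := n)).ne'
  rw [SDP.Feasible, ← sub_nonneg, sum_smul_F_sub_F₀, directSum_nonneg_iff]
  have h1 : (∀ p : Bool × X, 0 ≤ sgn p.1 • (1 / Real.sqrt (Fintype.card n)) •
      (choiMap (pointChoi e c p.2) 1 - A.effect p.2)) ↔
      ∀ x, choiMap (pointChoi e c x) 1 = A.effect x := by
    rw [Prod.forall, forall_comm]
    refine forall_congr' fun x => ?_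
    dsimp only
    rw [forall_nonneg_sgn_smul, smul_eq_zero_iff_right hs, sub_eq_zero]
  have h2 : (∀ p : Bool × Y, 0 ≤ c (Sum.inl ()) • (1 : Matrix n n ℂ) + sgn p.1 •
      (∑ x, choiMap (pointChoi e c x) (B.effect p.2) - B.effect p.2)) ↔
      ∀ y, -(c (Sum.inl ()) • (1 : Matrix n n ℂ)) ≤
          B.effect y - ∑ x, choiMap (pointChoi e c x) (B.effect y) ∧
        B.effect y - ∑ x, choiMap (pointChoi e c x) (B.effect y) ≤
          c (Sum.inl ()) • (1 : Matrix n n ℂ) := by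
    rw [Prod.forall, forall_comm]
    refine forall_congr' fun y => ?_
    simp only [Bool.forall_bool, sgn, Bool.false_eq_true, if_false, if_true, neg_smul, one_smul,
      neg_sub]
    refine and_congr (by rw [neg_le_iff_add_nonneg']) ?_
    rw [← neg_sub (B.effect y), ← sub_eq_add_neg, sub_nonneg]
  rw [h1, h2]
  tauto

/-- The feasible points of the program are the instruments implementing `A` together with a bound
on the disturbance of `B`. -/
theorem feasible_iff_exists_instrument (c : Unit ⊕ X × κ × κ → ℝ) :
    (disturbanceSDP A B e).Feasible c ↔
      ∃ I : Instrument n X, I.Implements A ∧ I.DisturbsAtMost B (c (Sum.inl ())) ∧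
        ∀ x i j, (e.E j * adjointMap (I.op x) (e.E i)).trace = (c (Sum.inr (x, i, j)) : ℂ) := by
  simp only [Instrument.DisturbsAtMost, adjointMap_channel]
  rw [feasible_iff, exists_instrument_iff A fun T =>
    (∀ y, -(c (Sum.inl ()) • (1 : Matrix n n ℂ)) ≤ B.effect y - ∑ x, T x (B.effect y) ∧
      B.effect y - ∑ x, T x (B.effect y) ≤ c (Sum.inl ()) • (1 : Matrix n n ℂ)) ∧
    ∀ x i j, (e.E j * T x (e.E i)).trace = (c (Sum.inr (x, i, j)) : ℂ)]
  constructor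
  · rintro ⟨h1, h2, h3⟩
    exact ⟨pointChoi e c, h1, h2, h3, fun x i j => e.trace_mul_choiMap_choi _ i j⟩
  · rintro ⟨J, h1, h2, h3, h4⟩
    obtain rfl : J = pointChoi e c := funext fun x => e.eq_choi (h4 x)
    exact ⟨h1, h2, h3⟩

/-- Every instrument gives a point of the program, as its coefficients are real. -/
theorem exists_feasible_iff (t : ℝ) :
    (∃ c, (disturbanceSDP A B e).Feasible c ∧ (disturbanceSDP A B e).objective c = t) ↔
      ∃ I : Instrument n X, I.Implements A ∧ I.DisturbsAtMost B t := by
  simp only [feasible_iff_exists_instrument, objective_disturbanceSDP]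
  constructor
  · rintro ⟨c, ⟨I, hA, hB, -⟩, rfl⟩
    exact ⟨I, hA, hB⟩
  · rintro ⟨I, hA, hB⟩
    refine ⟨Sum.elim (fun _ => t) fun l =>
      (e.E l.2.2 * adjointMap (I.op l.1) (e.E l.2.1)).trace.re, ⟨I, hA, hB, fun x i j => ?_⟩, rfl⟩
    obtain ⟨J, hJ, h⟩ := (I.cp x).exists_choi
    simp only [Sum.elim_inr, h]
    exact (e.trace_mul_choiMap_eq_ofReal hJ i j).symm

omit [DecidableEq Y] in
theorem Observable.nonempty_outcomes (B : Observable n Y) : Nonempty Y := by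
    by_contra hY
    rw [not_nonempty_iff] at hY
    obtain ⟨i⟩ := ‹Nonempty n›
    have h1 := congrFun (congrFun B.sum_eq_one i) i
    simp at h1

omit [DecidableEq X] [DecidableEq Y] in
theorem nonneg_of_disturbsAtMost {B : Observable n Y} {I : Instrument n X} {t : ℝ}
    (h : I.DisturbsAtMost B t) : 0 ≤ t := by
  obtain ⟨i⟩ := ‹Nonempty n›
  obtain ⟨y⟩ := B.nonempty_outcomes
  have h1 := re_diag_nonneg (sub_nonneg.2 ((h y).1.trans (h y).2)) i
  simp at h1
  linarith

/-- Values above `1` are allowed in the program but not in the definition of the disturbance; they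
do not affect the minimum, which is at most `1`. -/
theorem isLeast_primalValues :
    IsLeast (disturbanceSDP A B e).primalValues (disturbance A B) := by
  have hD := isLeast_disturbance A B
  refine ⟨(exists_feasible_iff A B e _).2 hD.1.2, fun t ht => ?_⟩
  obtain ⟨I, hA, hB⟩ := (exists_feasible_iff A B e t).1 ht
  rcases le_total t 1 with h | h
  · exact hD.2 ⟨⟨nonneg_of_disturbsAtMost hB, h⟩, I, hA, hB⟩
  · exact hD.1.1.2.trans h

omit [DecidableEq X] [Nonempty n] in
theorem sum_re_trace_effect_sq_le :
    ∑ x, (A.effect x).trace.re ^ 2 ≤ (Fintype.card n : ℝ) ^ 2 := by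
  have h0 : ∀ x, 0 ≤ (A.effect x).trace.re := fun x =>
    (Complex.nonneg_iff.1 (nonneg_iff_posSemidef.1 (A.nonneg x)).trace_nonneg).1
  have h1 : ∑ x, (A.effect x).trace.re = Fintype.card n := by
    rw [← Complex.re_sum, ← trace_sum, A.sum_eq_one, trace_one, Complex.natCast_re]
  rw [← h1]
  exact Finset.sum_sq_le_sq_sum_of_nonneg fun x _ => h0 x

/-- The coefficients of a feasible point are bounded: the Hilbert–Schmidt norm of a Choi matrix is
at most its trace, and the traces of the Choi matrices add up to `d`. -/
theorem sum_sq_le_of_feasible {c : Unit ⊕ X × κ × κ → ℝ} (hc : (disturbanceSDP A B e).Feasible c)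
    (h1 : (disturbanceSDP A B e).objective c ≤ 1) :
    ∑ l, c l ^ 2 ≤ 1 + (Fintype.card n : ℝ) ^ 2 := by
  obtain ⟨I, -, hB, -⟩ := (feasible_iff_exists_instrument A B e c).1 hc
  rw [objective_disturbanceSDP] at h1
  have h0 := nonneg_of_disturbsAtMost hB
  obtain ⟨hJ, hA, -⟩ := (feasible_iff A B e c).1 hc
  rw [Fintype.sum_sum_type, Fintype.sum_prod_type]
  refine add_le_add ?_ ((Finset.sum_le_sum fun x _ => ?_).trans (sum_re_trace_effect_sq_le A))
  · rw [Finset.univ_unique, Finset.sum_singleton]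
    exact pow_le_one₀ h0 h1
  · have h2 := re_trace_mul_self_le (hJ x)
    rw [pointChoi, e.trace_choi_mul_self, ← pointChoi, Complex.ofReal_re, ← trace_choiMap_one,
      hA] at h2
    rw [Fintype.sum_prod_type]
    exact h2

/-! ### The dual program -/

omit [Nonempty n] [Fintype κ] in
theorem trace_F₀_mul (P : Bool × X → Matrix n n ℂ) (Q : X → Matrix (n × n) (n × n) ℂ)
    (S : Bool × Y → Matrix n n ℂ) :
    ((disturbanceSDP A B e).F₀ * directSum P Q S).trace =
      ∑ x, (1 / Real.sqrt (Fintype.card n)) • (A.effect x * (P (true, x) - P (false, x))).trace +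
        ∑ y, (B.effect y * (S (true, y) - S (false, y))).trace := by
  simp only [disturbanceSDP, trace_directSum_mul, Fintype.sum_prod_type, Fintype.sum_bool, sgn,
    if_true, Bool.false_eq_true, if_false, one_smul, neg_smul, smul_mul, trace_smul, zero_mul,
    trace_zero, Finset.sum_const_zero, zero_add, mul_sub, trace_sub, smul_sub,
    Finset.sum_sub_distrib, Finset.sum_neg_distrib]
  ring

omit [Fintype κ] in
theorem trace_F_inl_mul (P : Bool × X → Matrix n n ℂ) (Q : X → Matrix (n × n) (n × n) ℂ)
    (S : Bool × Y → Matrix n n ℂ) :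
    ((disturbanceSDP A B e).F (Sum.inl ()) * directSum P Q S).trace =
      ∑ y, (S (true, y) + S (false, y)).trace := by
  simp [disturbanceSDP, trace_directSum_mul, Fintype.sum_prod_type, e.sqrt_smul_E_zero,
    Finset.sum_add_distrib]

omit [Nonempty n] [Fintype κ] in
theorem trace_F_inr_mul (P : Bool × X → Matrix n n ℂ) (Q : X → Matrix (n × n) (n × n) ℂ)
    (S : Bool × Y → Matrix n n ℂ) (x : X) (i j : κ) :
    ((disturbanceSDP A B e).F (Sum.inr (x, i, j)) * directSum P Q S).trace =
      (if i = e.zero then (e.E j * (P (true, x) - P (false, x))).trace else 0) +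
        (((e.E j ⊗ₖ (e.E i)ᵀ) * Q x).trace +
        ∑ y, (e.E i * B.effect y).trace * (e.E j * (S (true, y) - S (false, y))).trace) := by
  simp only [disturbanceSDP, Sum.elim_inr, trace_directSum_mul, re_trace_E_mul_smul]
  congr 1
  · rw [Fintype.sum_prod_type, Fintype.sum_bool]
    split_ifs with h
    · simp [h, sgn, ite_mul, apply_ite trace, sub_eq_add_neg, mul_add]
    · simp [h]
  congr 1
  · simp [ite_mul, apply_ite trace]
  · rw [Fintype.sum_prod_type, Fintype.sum_bool]
    simp [sgn, sub_eq_add_neg, mul_add, Finset.sum_add_distrib]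

omit [Fintype κ] in
/-- The dual program has a feasible point that is bounded below by a multiple of the identity. -/
theorem exists_dualFeasible_posDef :
    ∃ C, (disturbanceSDP A B e).DualFeasible C ∧ C.PosDef ∧
      (1 / (2 * Fintype.card n * Fintype.card Y) : ℝ) • 1 ≤ C := by
  have hY := B.nonempty_outcomes
  have hd : (0 : ℝ) < Fintype.card n := by exact_mod_cast Fintype.card_pos
  have hy : (0 : ℝ) < Fintype.card Y := by exact_mod_cast Fintype.card_pos
  have hs := OperatorBasis.sqrt_card_pos (n := n)
  set r : ℝ := 1 / (2 * Fintype.card n * Fintype.card Y) with hr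
  have hr0 : 0 < r := by positivity
  -- the constraints for `c_{x00}` force the excess `r √d` in the second of the blocks for `A_x`
  let C := directSum (fun p : Bool × X =>
      (if p.1 then r else r + r * Real.sqrt (Fintype.card n)) • (1 : Matrix n n ℂ))
    (fun _ => r • 1) (fun _ : Bool × Y => r • (1 : Matrix n n ℂ))
  have hC : r • 1 ≤ C := by
    rw [← directSum_one, ← sub_nonneg, directSum_sub, directSum_nonneg_iff]
    refine ⟨fun p => ?_, fun _ => by simp, fun _ => by simp⟩
    rw [← sub_smul]
    refine smul_nonneg_matrix ?_ PosSemidef.one.nonneg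
    split_ifs
    · simp
    · rw [add_sub_cancel_left]
      positivity
  have hC' : C.PosDef := by
    have h1 := (PosDef.one.smul hr0).add_posSemidef (nonneg_iff_posSemidef.1 (sub_nonneg.2 hC))
    rwa [add_sub_cancel] at h1
  refine ⟨C, ⟨hC'.posSemidef.nonneg, ?_⟩, hC', hC⟩
  rintro (⟨⟩ | ⟨x, i, j⟩)
  · rw [trace_F_inl_mul]
    simp [disturbanceSDP, trace_smul, hr]
    have hd' : (Fintype.card n : ℂ) ≠ 0 := by exact_mod_cast hd.ne'
    have hy' : (Fintype.card Y : ℂ) ≠ 0 := by exact_mod_cast hy.ne'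
    field_simp
    norm_num
  · rw [trace_F_inr_mul]
    have hsq : ((Real.sqrt (Fintype.card n) : ℝ) : ℂ) * ((Real.sqrt (Fintype.card n) : ℝ) : ℂ) =
      ((Real.sqrt (Fintype.card n) * Real.sqrt (Fintype.card n) : ℝ) : ℂ) := by push_cast; rfl
    simp only [disturbanceSDP, Sum.elim_inr, if_true, Bool.false_eq_true, if_false, ← sub_smul,
      sub_add_cancel_left, sub_self, trace_zero, mul_zero,
      Finset.sum_const_zero, add_zero, Matrix.mul_smul, Matrix.mul_one, trace_smul,
      trace_kronecker, trace_transpose, e.trace_E, Complex.ofReal_zero, Complex.real_smul]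
    split_ifs <;> push_cast <;> ring

omit [Fintype κ] in
/-- A pair `(H, K)` gives a point of the dual program with the same objective: `C` is the direct sum
of the positive and negative parts of `√d H_x`, of the slacks `∑ y, K_y ⊗ B_yᵀ - H_x ⊗ 1`, and of
the negative and positive parts of `K_y`. -/
theorem dualDisturbanceValues_subset :
    dualDisturbanceValues A B ⊆ (disturbanceSDP A B e).dualValues := by
  rintro _ ⟨H, K, h, rfl⟩
  have hs := OperatorBasis.sqrt_card_pos (n := n)
  have hH : ∀ x, IsSelfAdjoint (Real.sqrt (Fintype.card n) • H x) := fun x =>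
    isHermitian_real_smul (h.H_herm x) _
  have hK : ∀ y, IsSelfAdjoint (K y) := h.K_herm
  have hP : ∀ x, (Real.sqrt (Fintype.card n) • H x)⁺ - (Real.sqrt (Fintype.card n) • H x)⁻ =
    Real.sqrt (Fintype.card n) • H x := fun x => CFC.posPart_sub_negPart _ (hH x)
  have hS : ∀ y, (K y)⁻ - (K y)⁺ = -K y := fun y => by
    rw [← neg_sub, CFC.posPart_sub_negPart _ (hK y)]
  have hS' : ∀ y, (K y)⁻ + (K y)⁺ = CFC.abs (K y) := fun y => by
    rw [add_comm, CFC.posPart_add_negPart _ (hK y)]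
  refine ⟨directSum
    (fun p => if p.1 then (Real.sqrt (Fintype.card n) • H p.2)⁺
      else (Real.sqrt (Fintype.card n) • H p.2)⁻)
    (fun x => ∑ y, K y ⊗ₖ (B.effect y)ᵀ - H x ⊗ₖ 1)
    (fun p => if p.1 then (K p.2)⁻ else (K p.2)⁺), ⟨?_, ?_⟩, ?_⟩
  · refine directSum_nonneg_iff.2 ⟨fun p => ?_, fun x => sub_nonneg.2 (h.kronecker_le x),
      fun p => ?_⟩
    · split_ifs
      · exact CFC.posPart_nonneg _
      · exact CFC.negPart_nonneg _
    · split_ifs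
      · exact CFC.negPart_nonneg _
      · exact CFC.posPart_nonneg _
  · rintro (⟨⟩ | ⟨x, i, j⟩)
    · rw [trace_F_inl_mul]
      simp only [if_true, Bool.false_eq_true, if_false, hS', h.trace_abs]
      simp [disturbanceSDP]
    · rw [trace_F_inr_mul]
      simp only [if_true, Bool.false_eq_true, if_false, hP, hS, mul_sub, trace_sub,
        Finset.mul_sum, trace_sum, ← mul_kronecker_mul, trace_kronecker, ← transpose_mul,
        trace_transpose, mul_one, e.trace_E, Matrix.mul_smul, trace_smul,
        trace_neg, mul_neg, Finset.sum_neg_distrib, trace_mul_comm (B.effect _) (e.E i)]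
      simp only [disturbanceSDP, Sum.elim_inr, Complex.ofReal_zero, mul_comm (e.E j * K _).trace]
      split_ifs
      · simp [mul_comm]
        ring
      · simp [mul_comm]
  · rw [trace_F₀_mul, dualObjective]
    simp only [if_true, Bool.false_eq_true, if_false, hP, hS, Matrix.mul_smul, trace_smul,
      smul_smul,
      one_div_mul_cancel hs.ne', one_smul, Matrix.mul_neg, trace_neg, Finset.sum_neg_distrib,
      trace_mul_comm (A.effect _), trace_mul_comm (B.effect _), sub_eq_add_neg]

omit [DecidableEq X] [DecidableEq Y] in
/-- The dual value `0` is attained by multiples of the identity. -/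
theorem zero_mem_dualDisturbanceValues : 0 ∈ dualDisturbanceValues A B := by
  have hY := B.nonempty_outcomes
  have hd : (0 : ℝ) < Fintype.card n := by exact_mod_cast Fintype.card_pos
  have hy : (0 : ℝ) < Fintype.card Y := by exact_mod_cast Fintype.card_pos
  set r : ℝ := (Fintype.card n * Fintype.card Y : ℝ)⁻¹ with hr
  have hr0 : 0 ≤ r := by positivity
  have hherm := isHermitian_real_smul (isHermitian_one (n := n) (α := ℂ)) r
  refine ⟨fun _ => r • 1, fun _ => r • 1, ⟨fun _ => hherm, fun _ => hherm, fun x => ?_, ?_⟩, ?_⟩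
  · simp only [smul_kronecker, ← Finset.smul_sum]
    refine le_of_eq (congrArg _ ?_)
    ext ⟨i, a⟩ ⟨j, b⟩
    have h1 := congrFun (congrFun B.sum_eq_one b) a
    rw [Matrix.sum_apply] at h1
    simp only [Matrix.sum_apply, kronecker_apply, transpose_apply, ← Finset.mul_sum, h1,
      one_apply, eq_comm]
  · have h1 : 0 ≤ r • (1 : Matrix n n ℂ) := smul_nonneg_matrix hr0 PosSemidef.one.nonneg
    simp only [CFC.abs_of_nonneg _ h1]
    simp [trace_smul, hr]
  · rw [dualObjective]
    simp only [smul_mul, one_mul, trace_smul, ← Finset.smul_sum, ← trace_sum, A.sum_eq_one,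
      B.sum_eq_one, sub_self, Complex.zero_re]

omit [DecidableEq X] [DecidableEq Y] in
theorem isLUB_dualDisturbanceValues :
    IsLUB (dualDisturbanceValues A B) (disturbance A B) := by
  classical
  obtain ⟨e⟩ := OperatorBasis.nonempty (n := n)
  constructor
  · intro s hs
    obtain ⟨C, hC, rfl⟩ := dualDisturbanceValues_subset A B e hs
    obtain ⟨c, hc, h⟩ := (isLeast_primalValues A B e).1
    rw [← h]
    exact SDP.dual_le_objective _ hc hC
  · intro u hu
    refine le_of_forall_lt fun t ht => ?_
    rcases lt_or_ge t 0 with h0 | h0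
    · exact h0.trans_le (hu (zero_mem_dualDisturbanceValues A B))
    · obtain ⟨H, K, hHK, hlt⟩ := exists_isDualFeasible_lt h0 ht
      exact hlt.trans_le (hu ⟨H, K, hHK, rfl⟩)

theorem isLUB_dualValues :
    IsLUB (disturbanceSDP A B e).dualValues (disturbance A B) := by
  constructor
  · rintro _ ⟨C, hC, rfl⟩
    obtain ⟨c, hc, h⟩ := (isLeast_primalValues A B e).1
    rw [← h]
    exact SDP.dual_le_objective _ hc hC
  · exact fun u hu => (isLUB_dualDisturbanceValues A B).2
      fun s hs => hu (dualDisturbanceValues_subset A B e hs)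

end Program

end NonDisturbance

open NonDisturbance in
theorem mainTheorem12 {n X Y : Type*} [Fintype n] [DecidableEq n] [Nonempty n]
    [Fintype X] [DecidableEq X] [Fintype Y] [DecidableEq Y]
    (A : Observable n X) (B : Observable n Y) :
    -- the infimum defining the minimal disturbance is attained
    IsLeast (disturbanceValues A B) (disturbance A B) ∧
    -- selfadjoint operator bases exist, and for each of them the program has these properties
    Nonempty (OperatorBasis n (Fin (Fintype.card n ^ 2))) ∧
    (∀ e : OperatorBasis n (Fin (Fintype.card n ^ 2)),
      -- its points are the instruments implementing `A` together with a bound on the disturbance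
      (∀ c, (disturbanceSDP A B e).Feasible c ↔
        ∃ I : Instrument n X, I.Implements A ∧ I.DisturbsAtMost B (c (Sum.inl ())) ∧
          ∀ x i j, (e.E j * adjointMap (I.op x) (e.E i)).trace = (c (Sum.inr (x, i, j)) : ℂ)) ∧
      -- the minimal disturbance is its optimal value, and the optimum is attained
      IsLeast (disturbanceSDP A B e).primalValues (disturbance A B) ∧
      -- the dual program is strictly feasible and has the same value
      (∃ C, (disturbanceSDP A B e).DualFeasible C ∧ C.PosDef ∧
        (1 / (2 * Fintype.card n * Fintype.card Y) : ℝ) • 1 ≤ C) ∧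
      IsLUB (disturbanceSDP A B e).dualValues (disturbance A B) ∧
      -- a priori bound on the relevant part of the feasible set
      (∀ c, (disturbanceSDP A B e).Feasible c → (disturbanceSDP A B e).objective c ≤ 1 →
        ∑ l, c l ^ 2 ≤ 1 + (Fintype.card n : ℝ) ^ 2) ∧
      -- a primal certificate for non-disturbance
      (CanMeasureWithoutDisturbing A B ↔
        ∃ c, (disturbanceSDP A B e).Feasible c ∧ (disturbanceSDP A B e).objective c = 0)) ∧
    -- the numbers of real variables and of rows of the program are polynomial in the sizes
    Fintype.card (Unit ⊕ X × Fin (Fintype.card n ^ 2) × Fin (Fintype.card n ^ 2)) =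
      1 + Fintype.card X * Fintype.card n ^ 4 ∧
    Fintype.card ((n × (Bool × X)) ⊕ (((n × n) × X) ⊕ (n × (Bool × Y)))) =
      (2 * Fintype.card n + Fintype.card n ^ 2) * Fintype.card X +
        2 * Fintype.card n * Fintype.card Y ∧
    -- duality in terms of the operators `H_x` and `K_y`
    IsLUB (dualDisturbanceValues A B) (dualDisturbance A B) ∧
    dualDisturbance A B = disturbance A B ∧
    -- non-disturbance, and a dual certificate for disturbance
    (CanMeasureWithoutDisturbing A B ↔ disturbance A B = 0) ∧
    (¬ CanMeasureWithoutDisturbing A B ↔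
      ∃ (H : X → Matrix n n ℂ) (K : Y → Matrix n n ℂ),
        IsDualFeasible B H K ∧ 0 < dualObjective A B H K) := by
  have hLUB := isLUB_dualDisturbanceValues A B
  have hdual : dualDisturbance A B = disturbance A B :=
    hLUB.csSup_eq ⟨0, zero_mem_dualDisturbanceValues A B⟩
  refine ⟨isLeast_disturbance A B, OperatorBasis.nonempty, fun e =>
    ⟨feasible_iff_exists_instrument A B e, isLeast_primalValues A B e,
      exists_dualFeasible_posDef A B e, isLUB_dualValues A B e,
      fun c hc h1 => sum_sq_le_of_feasible A B e hc h1, ?_⟩, ?_, ?_, hdual ▸ hLUB, hdual,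
    canMeasureWithoutDisturbing_iff_disturbance A B, ?_⟩
  · rw [canMeasureWithoutDisturbing_iff_exists, exists_feasible_iff]
  · simp only [Fintype.card_sum, Fintype.card_unit, Fintype.card_prod, Fintype.card_fin]
    ring
  · simp only [Fintype.card_sum, Fintype.card_bool, Fintype.card_prod]
    ring
  · rw [canMeasureWithoutDisturbing_iff_disturbance]
    have h0 : 0 ≤ disturbance A B := (isLeast_disturbance A B).1.1.1
    constructor
    · exact fun h => exists_isDualFeasible_lt le_rfl (lt_of_le_of_ne h0 (Ne.symm h))
    · rintro ⟨H, K, hHK, hlt⟩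
      exact (hlt.trans_le (hLUB.1 ⟨H, K, hHK, rfl⟩)).ne'
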